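/- **Corollary 3.2 (Local bifurcation, Whitham).** Let $\tfrac12<\alpha<1$ and let $C^\alpha_{\rm even}(\mathbb S)$ be the Banach space of real-valued, even, $2\pi$-periodic, $\alpha$-Hölder continuous functions on $\mathbb R$, with norm $\|f\|_\infty+\sup_{x\ne y}|f(x)-f(y)|/|x-y|^\alpha$. Put $m(\xi)=(\tanh\xi/\xi)^{1/2}$ for $\xi\neq0$ and $m(0)=1$, and for $f=\sum_{k\ge0}a_k\cos(kx)\in C^\alpha_{\rm even}(\mathbb S)$ let $Lf(x)=\sum_{k\ge0}a_k\,m(k)\cos(kx)$. A *Whitham solution* is a pair $(\varphi,\mu)\in C^\alpha_{\rm even}(\mathbb S)\times\mathbb R$ with $$F(\varphi,\mu):=\mu\varphi-L\varphi-\varphi^2=0 ;$$ it is *nontrivial* if $\varphi\ne0$. A number $\mu$ is a *bifurcation point* if every neighbourhood of $(0,\mu)$ in $C^\alpha_{\rm even}(\mathbb S)\times\mathbb R$ contains a nontrivial Whitham solution. For integers $k\ge1$ put $\mu_k:=(\tanh(k)/k)^{1/2}$. **(i) Subcritical bifurcation.** For every integer $k\ge1$ there are $\delta>0$ and a real-analytic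 curve $(-\delta,\delta)\ni\varepsilon\mapsto(\varphi(\varepsilon),\mu(\varepsilon))\in C^\alpha_{\rm even}(\mathbb S)\times(0,1)$ of Whitham solutions with $(\varphi(0),\mu(0))=(0,\mu_k)$ and $\tfrac{d\varphi}{d\varepsilon}(0)=\cos(kx)$, such that every $\varphi(\varepsilon)$ is $2\pi/k$-periodic and $\varphi(\varepsilon)\neq0$ for $\varepsilon\ne0$. In some neighbourhood of $(0,\mu_k)$ the nontrivial Whitham solutions are exactly the points of this curve with $\varepsilon\neq0$. The bifurcation points $\mu>0$ are exactly the numbers $\mu_k$, $k\ge1$, and $\mu=1$. **(ii) Transcritical bifurcation.** For every $\mu>0$ the pairs $(0,\mu)$ and $(\mu-1,\mu)$ (constant function $\varphi=\mu-1$) are Whitham solutions, and in some neighbourhood of $(0,1)$ in $C^\alpha_{\rm even}(\mathbb S)\times\mathbb R$ every Whitham solution lies on one of these two curves. -/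

import Mathlib

open Set Filter Topology
open scoped NNReal BoundedContinuousFunction

noncomputable section

namespace Whitham

/-- The even, `2π`-periodic, `α`-Hölder continuous functions `ℝ → ℝ`, as a subspace of the
bounded continuous functions (boundedness and continuity are automatic for `0 < α`). -/
def evenHolderSubmodule (α : ℝ≥0) : Submodule ℝ (ℝ →ᵇ ℝ) where
  carrier := {f | (∀ x, f (-x) = f x) ∧ Function.Periodic f (2 * Real.pi) ∧ MemHolder α f}
  add_mem' := by
    rintro f g ⟨hf₁, hf₂, hf₃⟩ ⟨hg₁, hg₂, hg₃⟩
    refine ⟨fun x => ?_, fun x => ?_, hf₃.add hg₃⟩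
    · simp [hf₁ x, hg₁ x]
    · simp [hf₂ x, hg₂ x]
  zero_mem' := ⟨fun x => rfl, fun x => rfl, memHolder_zero⟩
  smul_mem' := by
    rintro c f ⟨hf₁, hf₂, hf₃⟩
    refine ⟨fun x => ?_, fun x => ?_, hf₃.smul⟩
    · simp [hf₁ x]
    · simp [hf₂ x]

/-- The Hölder space `C^α_even(𝕊)`. It is a type of its own, since its norm is not the sup norm
that it would inherit from the bounded continuous functions. -/
def EvenHolder (α : ℝ≥0) : Type := evenHolderSubmodule α

namespace EvenHolder

variable {α : ℝ≥0}

instance : AddCommGroup (EvenHolder α) := inferInstanceAs (AddCommGroup (evenHolderSubmodule α))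

instance : Module ℝ (EvenHolder α) := inferInstanceAs (Module ℝ (evenHolderSubmodule α))

/-- The underlying bounded continuous function. -/
def toBCF (f : EvenHolder α) : ℝ →ᵇ ℝ := Subtype.val (p := (· ∈ evenHolderSubmodule α)) f

instance : CoeFun (EvenHolder α) (fun _ => ℝ → ℝ) := ⟨fun f => f.toBCF⟩

theorem memHolder (f : EvenHolder α) : MemHolder α (f : ℝ → ℝ) :=
  (Subtype.prop (p := (· ∈ evenHolderSubmodule α)) f).2.2

/-- The Hölder norm: the sup norm plus the `α`-Hölder seminorm. -/
instance : Norm (EvenHolder α) := ⟨fun f => ‖f.toBCF‖ + (nnHolderNorm α (f : ℝ → ℝ) : ℝ)⟩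

theorem norm_def (f : EvenHolder α) :
    ‖f‖ = ‖f.toBCF‖ + (nnHolderNorm α (f : ℝ → ℝ) : ℝ) := rfl

theorem normedSpaceCore (α : ℝ≥0) : NormedSpace.Core ℝ (EvenHolder α) where
  norm_nonneg f := by
    rw [norm_def]; positivity
  norm_smul c f := by
    have h : nnHolderNorm α ((c • f : EvenHolder α) : ℝ → ℝ)
        = ‖c‖₊ * nnHolderNorm α (f : ℝ → ℝ) := f.memHolder.nnHolderNorm_smul c
    have h' : ‖(c • f : EvenHolder α).toBCF‖ = ‖c‖ * ‖f.toBCF‖ := norm_smul c f.toBCF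
    rw [norm_def, norm_def, h, h', NNReal.coe_mul, coe_nnnorm, mul_add]
  norm_triangle f g := by
    have h : nnHolderNorm α ((f + g : EvenHolder α) : ℝ → ℝ)
        ≤ nnHolderNorm α (f : ℝ → ℝ) + nnHolderNorm α (g : ℝ → ℝ) :=
      f.memHolder.nnHolderNorm_add_le g.memHolder
    have h' : ‖(f + g : EvenHolder α).toBCF‖ ≤ ‖f.toBCF‖ + ‖g.toBCF‖ :=
      norm_add_le f.toBCF g.toBCF
    have h'' : (nnHolderNorm α ((f + g : EvenHolder α) : ℝ → ℝ) : ℝ)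
        ≤ nnHolderNorm α (f : ℝ → ℝ) + nnHolderNorm α (g : ℝ → ℝ) := by exact_mod_cast h
    rw [norm_def, norm_def, norm_def]
    linarith
  norm_eq_zero_iff f := by
    constructor
    · intro h
      rw [norm_def] at h
      have h1 : ‖f.toBCF‖ = 0 :=
        le_antisymm (by linarith [NNReal.coe_nonneg (nnHolderNorm α (f : ℝ → ℝ))])
          (norm_nonneg _)
      exact Subtype.ext (norm_eq_zero.mp h1)
    · rintro rfl
      have h1 : ‖(0 : EvenHolder α).toBCF‖ = 0 := norm_zero (E := ℝ →ᵇ ℝ)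
      have h2 : nnHolderNorm α ((0 : EvenHolder α) : ℝ → ℝ) = 0 := nnHolderNorm_zero ℝ α
      rw [norm_def, h1, h2]
      simp

instance : NormedAddCommGroup (EvenHolder α) := NormedAddCommGroup.ofCore (normedSpaceCore α)

instance : NormedSpace ℝ (EvenHolder α) := NormedSpace.ofCore (normedSpaceCore α)

/-- Constant functions. -/
def const (α : ℝ≥0) (c : ℝ) : EvenHolder α :=
  (⟨BoundedContinuousFunction.const ℝ c, fun _ => rfl, fun _ => rfl, memHolder_const⟩ :
    evenHolderSubmodule α)

end EvenHolder

/-- The Whitham symbol `m(ξ) = (tanh ξ / ξ)^{1/2}`, with its continuous value `1` at `ξ = 0`. -/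
def symbol (ξ : ℝ) : ℝ := if ξ = 0 then 1 else Real.sqrt (Real.tanh ξ / ξ)

/-- The cosine coefficients `a_k` of an even `2π`-periodic function `f = ∑ a_k cos(kx)`. -/
def cosCoeff (f : ℝ → ℝ) (k : ℕ) : ℝ :=
  if k = 0 then (2 * Real.pi)⁻¹ * ∫ x in (-Real.pi)..Real.pi, f x
  else Real.pi⁻¹ * ∫ x in (-Real.pi)..Real.pi, f x * Real.cos (k * x)

/-- The Fourier multiplier operator `L f (x) = ∑ a_k m(k) cos(kx)`. The series converges
absolutely for `f` in `C^α_even(𝕊)` with `α > 1/2`, because `|a_k| = O(k^{-α})` and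
`m(k) = O(k^{-1/2})`. -/
def L (f : ℝ → ℝ) (x : ℝ) : ℝ := ∑' k : ℕ, cosCoeff f k * symbol k * Real.cos (k * x)

/-- The Whitham operator `F(φ, μ) = μ φ - L φ - φ²`. -/
def F (φ : ℝ → ℝ) (μ : ℝ) (x : ℝ) : ℝ := μ * φ x - L φ x - φ x ^ 2

/-- `(φ, μ)` solves the steady Whitham equation `F(φ, μ) = 0`. -/
def IsSolution {α : ℝ≥0} (p : EvenHolder α × ℝ) : Prop := ∀ x, F p.1 p.2 x = 0

/-- `μ` is a bifurcation point (from the trivial curve `μ ↦ (0, μ)`): every neighbourhood of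
`(0, μ)` in `C^α_even(𝕊) × ℝ` contains a nontrivial solution. -/
def IsBifurcationPoint (α : ℝ≥0) (μ : ℝ) : Prop :=
  ∃ᶠ p in 𝓝 ((0 : EvenHolder α), μ), p.1 ≠ 0 ∧ IsSolution p

/-- The number `μ_k = (tanh k / k)^{1/2}`, used for `k ≥ 1`. -/
def muStar (k : ℕ) : ℝ := Real.sqrt (Real.tanh k / k)

end Whitham

end

noncomputable section

namespace Whitham

namespace EvenHolder

variable {α : ℝ≥0}

theorem apply_neg (f : EvenHolder α) (x : ℝ) : f (-x) = f x :=
  (Subtype.prop (p := (· ∈ evenHolderSubmodule α)) f).1 x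

theorem periodic (f : EvenHolder α) : Function.Periodic f (2 * Real.pi) :=
  (Subtype.prop (p := (· ∈ evenHolderSubmodule α)) f).2.1

theorem continuous (f : EvenHolder α) : Continuous (f : ℝ → ℝ) := f.toBCF.continuous

@[ext] theorem ext {f g : EvenHolder α} (h : ∀ x, f x = g x) : f = g :=
  Subtype.ext (BoundedContinuousFunction.ext h)

@[simp] theorem zero_apply (x : ℝ) : (0 : EvenHolder α) x = 0 := rfl
@[simp] theorem add_apply (f g : EvenHolder α) (x : ℝ) : (f + g) x = f x + g x := rfl
@[simp] theorem sub_apply (f g : EvenHolder α) (x : ℝ) : (f - g) x = f x - g x := rfl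
@[simp] theorem smul_apply (c : ℝ) (f : EvenHolder α) (x : ℝ) : (c • f) x = c * f x := rfl
@[simp] theorem const_apply (c x : ℝ) : const α c x = c := rfl

theorem holderWith_of_abs_sub_le {f : ℝ → ℝ} {C : ℝ}
    (h : ∀ x y, |f x - f y| ≤ C * |x - y| ^ (α : ℝ)) : HolderWith C.toNNReal α f := by
  have hC : 0 ≤ C := by simpa using (abs_nonneg _).trans (h 1 0)
  intro x y
  rw [edist_dist, edist_dist, ENNReal.ofReal_rpow_of_nonneg dist_nonneg α.coe_nonneg,
    show ((C.toNNReal : ℝ≥0) : ENNReal) = ENNReal.ofReal C from rfl, ← ENNReal.ofReal_mul hC]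
  exact ENNReal.ofReal_le_ofReal (h x y)

/-- An even, periodic, continuous function with a Hölder bound, as an element of `EvenHolder α`. -/
def mk (f : ℝ → ℝ) (hf : Continuous f) (M C : ℝ) (heven : ∀ x, f (-x) = f x)
    (hper : Function.Periodic f (2 * Real.pi)) (hM : ∀ x, |f x| ≤ M)
    (hC : ∀ x y, |f x - f y| ≤ C * |x - y| ^ (α : ℝ)) : EvenHolder α :=
  (⟨BoundedContinuousFunction.ofNormedAddCommGroup f hf M hM, heven, hper,
    (holderWith_of_abs_sub_le hC).memHolder⟩ : evenHolderSubmodule α)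

/-- The Hölder seminorm. -/
def seminorm (f : EvenHolder α) : ℝ := nnHolderNorm α (f : ℝ → ℝ)

theorem seminorm_nonneg (f : EvenHolder α) : 0 ≤ f.seminorm := NNReal.coe_nonneg _

theorem norm_eq (f : EvenHolder α) : ‖f‖ = ‖f.toBCF‖ + f.seminorm := rfl

theorem abs_apply_le_norm_toBCF (f : EvenHolder α) (x : ℝ) : |f x| ≤ ‖f.toBCF‖ :=
  f.toBCF.norm_coe_le_norm x

theorem norm_toBCF_le (f : EvenHolder α) : ‖f.toBCF‖ ≤ ‖f‖ := by
  rw [norm_eq]; linarith [f.seminorm_nonneg]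

theorem seminorm_le_norm (f : EvenHolder α) : f.seminorm ≤ ‖f‖ := by
  rw [norm_eq]; linarith [norm_nonneg f.toBCF]

theorem abs_apply_le (f : EvenHolder α) (x : ℝ) : |f x| ≤ ‖f‖ :=
  (f.abs_apply_le_norm_toBCF x).trans f.norm_toBCF_le

theorem abs_sub_le (f : EvenHolder α) (x y : ℝ) :
    |f x - f y| ≤ f.seminorm * |x - y| ^ (α : ℝ) :=
  f.memHolder.holderWith.dist_le x y

theorem norm_le {f : EvenHolder α} {M C : ℝ} (hM : ∀ x, |f x| ≤ M)
    (hC : ∀ x y, |f x - f y| ≤ C * |x - y| ^ (α : ℝ)) : ‖f‖ ≤ M + C := by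
  have hC0 : 0 ≤ C := by simpa using (abs_nonneg _).trans (hC 1 0)
  have hM0 : 0 ≤ M := (abs_nonneg _).trans (hM 0)
  have h1 : ‖f.toBCF‖ ≤ M := (BoundedContinuousFunction.norm_le hM0).2 hM
  have h2 : f.seminorm ≤ C := by
    have := (holderWith_of_abs_sub_le hC).nnholderNorm_le
    simpa [seminorm, Real.coe_toNNReal _ hC0] using NNReal.coe_le_coe.2 this
  rw [norm_eq]; linarith

/-- Evaluation at a point. -/
def evalCLM (x : ℝ) : EvenHolder α →L[ℝ] ℝ :=
  LinearMap.mkContinuous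
    { toFun := fun f => f x, map_add' := fun _ _ => rfl, map_smul' := fun _ _ => rfl } 1
    fun f => (f.abs_apply_le x).trans_eq (one_mul _).symm

@[simp] theorem evalCLM_apply (x : ℝ) (f : EvenHolder α) : evalCLM x f = f x := rfl

instance : CompleteSpace (EvenHolder α) := by
  refine Metric.complete_of_cauchySeq_tendsto fun u hu => ?_
  have hpt : ∀ x, ∃ y, Tendsto (fun n => u n x) atTop (𝓝 y) := fun x =>
    cauchySeq_tendsto_of_complete (hu.map (evalCLM (α := α) x).uniformContinuous)
  have hB : CauchySeq fun n => (u n).toBCF := by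
    refine Metric.cauchySeq_iff.2 fun ε hε => ?_
    obtain ⟨N, hN⟩ := Metric.cauchySeq_iff.1 hu ε hε
    refine ⟨N, fun m hm n hn => lt_of_le_of_lt ?_ (hN m hm n hn)⟩
    rw [dist_eq_norm, dist_eq_norm]
    exact norm_toBCF_le (u m - u n)
  obtain ⟨g, hg⟩ := cauchySeq_tendsto_of_complete hB
  have hgx : ∀ x, Tendsto (fun n => u n x) atTop (𝓝 (g x)) := fun x =>
    ((BoundedContinuousFunction.evalCLM ℝ x).continuous.tendsto g).comp hg
  obtain ⟨R, hR⟩ := hu.isBounded_range.exists_norm_le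
  have hR' : ∀ n, ‖u n‖ ≤ R := fun n => hR _ (mem_range_self n)
  let G : EvenHolder α := mk g g.continuous ‖g‖ R
    (fun x => tendsto_nhds_unique (hgx (-x)) (by simpa only [apply_neg] using hgx x))
    (fun x => tendsto_nhds_unique (hgx (x + 2 * Real.pi))
      (by simpa only [(u _).periodic x] using hgx x))
    g.norm_coe_le_norm
    (fun x y => le_of_tendsto ((hgx x).sub (hgx y)).abs (Eventually.of_forall fun n =>
      ((u n).abs_sub_le x y).trans (by
        gcongr; exact (u n).seminorm_le_norm.trans (hR' n))))
  refine ⟨G, Metric.tendsto_atTop.2 fun ε hε => ?_⟩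
  obtain ⟨N, hN⟩ := Metric.cauchySeq_iff.1 hu (ε / 3) (by positivity)
  refine ⟨N, fun n hn => ?_⟩
  have hN' : ∀ m ≥ N, ‖u n - u m‖ ≤ ε / 3 := fun m hm => by
    rw [← dist_eq_norm]; exact (hN n hn m hm).le
  have : ‖u n - G‖ ≤ ε / 3 + ε / 3 := by
    refine norm_le (fun x => ?_) fun x y => ?_
    · refine le_of_tendsto ((hgx x).const_sub (u n x)).abs ?_
      filter_upwards [eventually_ge_atTop N] with m hm
      exact ((u n - u m).abs_apply_le x).trans (hN' m hm)
    · refine le_of_tendsto (((hgx x).const_sub (u n x)).sub ((hgx y).const_sub (u n y))).abs ?_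
      filter_upwards [eventually_ge_atTop N] with m hm
      refine ((u n - u m).abs_sub_le x y).trans ?_
      gcongr
      exact (seminorm_le_norm _).trans (hN' m hm)
  rw [dist_eq_norm]; linarith

theorem abs_mul_sub_mul_le (f g : EvenHolder α) (x y : ℝ) :
    |f x * g x - f y * g y| ≤
      (‖f.toBCF‖ * g.seminorm + f.seminorm * ‖g.toBCF‖) * |x - y| ^ (α : ℝ) := by
  calc |f x * g x - f y * g y| = |f x * (g x - g y) + (f x - f y) * g y| := by ring_nf
    _ ≤ |f x| * |g x - g y| + |f x - f y| * |g y| := by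
      rw [← abs_mul, ← abs_mul]; exact abs_add_le _ _
    _ ≤ ‖f.toBCF‖ * (g.seminorm * |x - y| ^ (α : ℝ))
        + f.seminorm * |x - y| ^ (α : ℝ) * ‖g.toBCF‖ := by
      gcongr
      · exact f.abs_apply_le_norm_toBCF x
      · exact g.abs_sub_le x y
      · exact mul_nonneg f.seminorm_nonneg (by positivity)
      · exact f.abs_sub_le x y
      · exact g.abs_apply_le_norm_toBCF y
    _ = _ := by ring

theorem abs_mul_apply_le (f g : EvenHolder α) (x : ℝ) :
    |f x * g x| ≤ ‖f.toBCF‖ * ‖g.toBCF‖ := by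
  rw [abs_mul]
  exact mul_le_mul (f.abs_apply_le_norm_toBCF x) (g.abs_apply_le_norm_toBCF x) (abs_nonneg _)
    (norm_nonneg _)

scoped instance : Mul (EvenHolder α) := ⟨fun f g =>
  mk (fun x => f x * g x) (f.continuous.mul g.continuous) _ _
    (fun x => by rw [f.apply_neg, g.apply_neg])
    (fun x => by simp only [f.periodic x, g.periodic x])
    (abs_mul_apply_le f g) (abs_mul_sub_mul_le f g)⟩

scoped instance : One (EvenHolder α) := ⟨const α 1⟩

@[simp] theorem mul_apply (f g : EvenHolder α) (x : ℝ) : (f * g) x = f x * g x := rfl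
@[simp] theorem one_apply (x : ℝ) : (1 : EvenHolder α) x = 1 := rfl

theorem norm_mul_le' (f g : EvenHolder α) : ‖f * g‖ ≤ ‖f‖ * ‖g‖ := by
  refine (norm_le (abs_mul_apply_le f g) (abs_mul_sub_mul_le f g)).trans ?_
  rw [norm_eq, norm_eq]
  nlinarith [mul_nonneg f.seminorm_nonneg g.seminorm_nonneg]

scoped instance : NormedCommRing (EvenHolder α) where
  __ := (inferInstance : NormedAddCommGroup (EvenHolder α))
  mul := (· * ·)
  one := 1
  left_distrib f g h := by ext x; simp [mul_add]
  right_distrib f g h := by ext x; simp [add_mul]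
  zero_mul f := by ext x; simp
  mul_zero f := by ext x; simp
  mul_assoc f g h := by ext x; simp [mul_assoc]
  one_mul f := by ext x; simp
  mul_one f := by ext x; simp
  mul_comm f g := by ext x; simp [mul_comm]
  norm_mul_le := norm_mul_le'

scoped instance : Algebra ℝ (EvenHolder α) := Algebra.ofModule
  (fun c f g => by ext x; simp [mul_assoc]) (fun c f g => by ext x; simp; ring)

scoped instance : NormedAlgebra ℝ (EvenHolder α) where
  norm_smul_le c f := (norm_smul c f).le

theorem const_eq_smul_one (c : ℝ) : const α c = c • (1 : EvenHolder α) := by ext x; simp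

@[simp] theorem pow_apply (f : EvenHolder α) (n : ℕ) (x : ℝ) : (f ^ n) x = f x ^ n := by
  induction n with
  | zero => simp
  | succ n ih => simp [pow_succ, ih]

theorem sum_apply {ι : Type*} (s : Finset ι) (f : ι → EvenHolder α) (x : ℝ) :
    (∑ i ∈ s, f i) x = ∑ i ∈ s, f i x := map_sum (evalCLM x) f s

theorem min_two_le_rpow {t a : ℝ} (ht : 0 ≤ t) (ha : 0 ≤ a) (ha' : a ≤ 1) :
    min 2 t ≤ 2 * t ^ a := by
  rcases le_total t 1 with h | h
  · have : t ≤ t ^ a := by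
      rcases ht.eq_or_lt with rfl | h0
      · positivity
      · simpa using Real.rpow_le_rpow_of_exponent_ge h0 h ha'
    exact (min_le_right _ _).trans (by linarith)
  · have := Real.one_le_rpow h ha
    exact (min_le_left _ _).trans (by linarith)

/-- The function `cos (k x)`. -/
def cosMode (hα : α ≤ 1) (k : ℕ) : EvenHolder α :=
  mk (fun x => Real.cos (k * x)) (by fun_prop) 1 (2 * (k : ℝ) ^ (α : ℝ))
    (fun x => by simp)
    (fun x => by simp [mul_add])
    (fun x => Real.abs_cos_le_one _)
    (fun x y => by
      have h1 : |Real.cos (k * x) - Real.cos (k * y)| ≤ 2 := by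
        have := abs_sub (Real.cos (k * x)) (Real.cos (k * y))
        linarith [Real.abs_cos_le_one (k * x), Real.abs_cos_le_one (k * y)]
      have h2 : |Real.cos (k * x) - Real.cos (k * y)| ≤ k * |x - y| := by
        have := Real.lipschitzWith_cos.dist_le_mul (k * x) (k * y)
        simpa [Real.dist_eq, ← mul_sub, abs_mul] using this
      refine (le_min h1 h2).trans ((min_two_le_rpow (by positivity) α.coe_nonneg
        (by exact_mod_cast hα)).trans_eq ?_)
      rw [Real.mul_rpow (by positivity) (abs_nonneg _), mul_assoc])

@[simp] theorem cosMode_apply (hα : α ≤ 1) (k : ℕ) (x : ℝ) :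
    cosMode hα k x = Real.cos (k * x) := rfl

theorem cosMode_zero (hα : α ≤ 1) : cosMode hα 0 = 1 := by ext x; simp

end EvenHolder

section

open EvenHolder

variable {α : ℝ≥0}

/-- The weight `1` of the zero frequency and `2` of the others in the cosine series. -/
def freqWeight (k : ℕ) : ℝ := if k = 0 then 1 else 2

theorem cosCoeff_eq (f : ℝ → ℝ) (k : ℕ) :
    cosCoeff f k =
      (2 * Real.pi)⁻¹ * ∫ x in (-Real.pi)..Real.pi, f x * (freqWeight k * Real.cos (k * x)) := by
  rcases eq_or_ne k 0 with rfl | hk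
  · simp [cosCoeff, freqWeight]
  · simp only [cosCoeff, freqWeight, hk, if_false]
    rw [show (fun x => f x * (2 * Real.cos (k * x))) = fun x => 2 * (f x * Real.cos (k * x)) from
      funext fun x => by ring, intervalIntegral.integral_const_mul, mul_inv]
    ring

theorem abs_freqWeight_mul_cos_le (k : ℕ) (x : ℝ) : |freqWeight k * Real.cos (k * x)| ≤ 2 := by
  have h1 : |freqWeight k| ≤ 2 := by unfold freqWeight; split_ifs <;> norm_num
  rw [abs_mul]
  nlinarith [Real.abs_cos_le_one (k * x), abs_nonneg (freqWeight k),
    abs_nonneg (Real.cos (k * x))]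

/-- Cosine coefficients as continuous linear functionals. -/
def coeffCLM (k : ℕ) : EvenHolder α →L[ℝ] ℝ :=
  LinearMap.mkContinuous
    { toFun := fun f => cosCoeff f k
      map_add' := fun f g => by
        rw [cosCoeff_eq, cosCoeff_eq, cosCoeff_eq, ← mul_add, ← intervalIntegral.integral_add]
        · simp only [add_apply, add_mul]
        · exact (f.continuous.mul (by fun_prop)).intervalIntegrable _ _
        · exact (g.continuous.mul (by fun_prop)).intervalIntegrable _ _
      map_smul' := fun c f => by
        simp only [cosCoeff_eq, smul_apply, mul_assoc, intervalIntegral.integral_const_mul,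
          RingHom.id_apply, smul_eq_mul]
        ring } 2
    fun f => by
      change ‖cosCoeff f k‖ ≤ 2 * ‖f‖
      have h := intervalIntegral.norm_integral_le_of_norm_le_const (a := -Real.pi) (b := Real.pi)
        (f := fun x => f x * (freqWeight k * Real.cos (k * x))) (C := 2 * ‖f‖) fun x _ => by
          rw [norm_mul, mul_comm]
          exact mul_le_mul (abs_freqWeight_mul_cos_le k x) (f.abs_apply_le x) (abs_nonneg _)
            (by norm_num)
      rw [cosCoeff_eq, norm_mul, norm_inv, Real.norm_of_nonneg Real.two_pi_pos.le]
      rw [sub_neg_eq_add, ← two_mul, abs_of_pos Real.two_pi_pos] at h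
      rw [inv_mul_le_iff₀ Real.two_pi_pos]
      linarith

@[simp] theorem coeffCLM_apply (k : ℕ) (f : EvenHolder α) : coeffCLM k f = cosCoeff f k := rfl

theorem integral_cos_int_mul (z : ℤ) :
    ∫ x in (-Real.pi)..Real.pi, Real.cos (z * x) = if z = 0 then 2 * Real.pi else 0 := by
  split_ifs with h
  · subst h; simp; ring
  · have hz : (z : ℝ) ≠ 0 := by exact_mod_cast h
    rw [intervalIntegral.integral_comp_mul_left (fun x => Real.cos x) hz]
    simp [Real.sin_int_mul_pi]

theorem cosCoeff_cosMode (hα : α ≤ 1) (i j : ℕ) :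
    cosCoeff (cosMode hα i) j = if i = j then 1 else 0 := by
  have h : ∀ x : ℝ, Real.cos (i * x) * (freqWeight j * Real.cos (j * x)) =
      freqWeight j / 2 * (Real.cos (((i + j : ℕ) : ℤ) * x) + Real.cos (((i : ℤ) - j : ℤ) * x)) := by
    intro x
    push_cast
    rw [add_mul, sub_mul, Real.cos_add, Real.cos_sub]
    ring
  have hint : ∀ z : ℤ, IntervalIntegrable (fun x => Real.cos (z * x)) MeasureTheory.volume
      (-Real.pi) Real.pi := fun z => (by fun_prop : Continuous _).intervalIntegrable _ _
  rw [cosCoeff_eq]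
  simp only [cosMode_apply, h]
  rw [intervalIntegral.integral_const_mul, intervalIntegral.integral_add (hint _) (hint _),
    integral_cos_int_mul, integral_cos_int_mul]
  have hpi := Real.pi_ne_zero
  rcases eq_or_ne i j with rfl | hij
  · rcases eq_or_ne i 0 with rfl | hi
    · simp [freqWeight]; field_simp; norm_num
    · have : ((i + i : ℕ) : ℤ) ≠ 0 := by omega
      simp only [this, if_false, sub_self, if_true, freqWeight, hi]
      field_simp; norm_num
  · rw [if_neg (by omega), if_neg (by omega), if_neg hij]
    simp

theorem EvenHolder.integral_mul_sin (f : EvenHolder α) (k : ℕ) :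
    ∫ x in (-Real.pi)..Real.pi, f x * Real.sin (k * x) = 0 := by
  have h := intervalIntegral.integral_comp_neg (a := -Real.pi) (b := Real.pi)
    (fun x => f x * Real.sin (k * x))
  simp only [f.apply_neg, mul_neg, Real.sin_neg, neg_neg, intervalIntegral.integral_neg] at h
  linarith

theorem abs_cosCoeff_le (f : EvenHolder α) {k : ℕ} (hk : k ≠ 0) :
    |cosCoeff f k| ≤ f.seminorm * (Real.pi / k) ^ (α : ℝ) := by
  have hk' : (0 : ℝ) < k := by exact_mod_cast Nat.pos_of_ne_zero hk
  set I := ∫ x in (-Real.pi)..Real.pi, f x * Real.cos (k * x) with hI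
  have hc1 : Continuous fun x => f x * Real.cos (k * x) := f.continuous.mul (by fun_prop)
  have hc2 : Continuous fun x => f (x + Real.pi / k) * Real.cos (k * x) :=
    (f.continuous.comp (by fun_prop)).mul (by fun_prop)
  have hper : Function.Periodic (fun x => f x * Real.cos (k * x)) (2 * Real.pi) := fun x => by
    simp [f.periodic x, mul_add]
  have hshift : I = -∫ x in (-Real.pi)..Real.pi, f (x + Real.pi / k) * Real.cos (k * x) := by
    have h1 : ∫ x in (-Real.pi)..Real.pi, f (x + Real.pi / k) * Real.cos (k * (x + Real.pi / k)) =
        I := by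
      rw [intervalIntegral.integral_comp_add_right (fun x => f x * Real.cos (k * x))]
      have := hper.intervalIntegral_add_eq (-Real.pi + Real.pi / k) (-Real.pi)
      rw [hI]
      convert this using 2 <;> ring
    rw [← h1, ← intervalIntegral.integral_neg]
    refine intervalIntegral.integral_congr fun x _ => ?_
    rw [mul_add, mul_div_cancel₀ _ hk'.ne', Real.cos_add_pi]
    ring
  have h2 : 2 * I = ∫ x in (-Real.pi)..Real.pi,
      (f x * Real.cos (k * x) - f (x + Real.pi / k) * Real.cos (k * x)) := by
    rw [intervalIntegral.integral_sub (hc1.intervalIntegrable _ _) (hc2.intervalIntegrable _ _)]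
    linarith
  have h3 : |2 * I| ≤ f.seminorm * (Real.pi / k) ^ (α : ℝ) * |Real.pi - -Real.pi| := by
    rw [h2]
    refine intervalIntegral.norm_integral_le_of_norm_le_const (E := ℝ) fun x _ => ?_
    rw [← sub_mul, norm_mul]
    have h4 := f.abs_sub_le x (x + Real.pi / k)
    rw [sub_add_cancel_left, abs_neg, abs_of_pos (div_pos Real.pi_pos hk')] at h4
    calc _ ≤ f.seminorm * (Real.pi / k) ^ (α : ℝ) * 1 :=
          mul_le_mul h4 (Real.abs_cos_le_one _) (abs_nonneg _) ((abs_nonneg _).trans h4)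
      _ = _ := mul_one _
  have hpi := Real.pi_pos
  rw [abs_mul, abs_two, sub_neg_eq_add, ← two_mul, abs_of_pos Real.two_pi_pos] at h3
  simp only [cosCoeff, hk, if_false]
  rw [abs_mul, abs_of_pos (inv_pos.2 hpi), inv_mul_le_iff₀ hpi]
  linarith

/-- The projection `f ↦ a_k cos (k x)`. -/
def modeProj (hα : α ≤ 1) (k : ℕ) : EvenHolder α →L[ℝ] EvenHolder α :=
  (coeffCLM k).smulRight (cosMode hα k)

theorem modeProj_apply (hα : α ≤ 1) (k : ℕ) (f : EvenHolder α) :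
    modeProj hα k f = cosCoeff f k • cosMode hα k := rfl

theorem modeProj_apply_apply (hα : α ≤ 1) (k : ℕ) (f : EvenHolder α) (x : ℝ) :
    modeProj hα k f x = cosCoeff f k * Real.cos (k * x) := rfl

theorem integral_comp_sub_mul (f : EvenHolder α) {g : ℝ → ℝ}
    (hg : Function.Periodic g (2 * Real.pi)) (x : ℝ) :
    ∫ s in (-Real.pi)..Real.pi, f (x - s) * g s =
      ∫ t in (-Real.pi)..Real.pi, f t * g (x - t) := by
  have hper : Function.Periodic (fun t => f t * g (x - t)) (2 * Real.pi) := fun t => by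
    have := hg (x - (t + 2 * Real.pi))
    rw [show x - (t + 2 * Real.pi) + 2 * Real.pi = x - t by ring] at this
    simp [f.periodic t, this]
  have h := intervalIntegral.integral_comp_sub_left (a := -Real.pi) (b := Real.pi)
    (fun t => f t * g (x - t)) x
  simp only [sub_sub_cancel] at h
  rw [h]
  have := hper.intervalIntegral_add_eq (x - Real.pi) (-Real.pi)
  convert this using 2 <;> ring

theorem modeProj_eq_integral (hα : α ≤ 1) (k : ℕ) (f : EvenHolder α) (x : ℝ) :
    modeProj hα k f x = (2 * Real.pi)⁻¹ *
      ∫ s in (-Real.pi)..Real.pi, f (x - s) * (freqWeight k * Real.cos (k * s)) := by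
  rw [integral_comp_sub_mul f (fun s => by simp [mul_add]), modeProj_apply_apply, cosCoeff_eq,
    mul_assoc, ← intervalIntegral.integral_mul_const]
  have h : ∀ t : ℝ, f t * (freqWeight k * Real.cos (k * (x - t))) =
      f t * (freqWeight k * Real.cos (k * t)) * Real.cos (k * x) +
        freqWeight k * Real.sin (k * x) * (f t * Real.sin (k * t)) := fun t => by
    rw [mul_sub, Real.cos_sub]; ring
  simp only [h]
  rw [intervalIntegral.integral_add, intervalIntegral.integral_const_mul _
    (fun t => f t * Real.sin (k * t)), f.integral_mul_sin, mul_zero, add_zero]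
  · exact ((f.continuous.mul (by fun_prop)).mul (by fun_prop)).intervalIntegrable _ _
  · exact (continuous_const.mul (f.continuous.mul (by fun_prop))).intervalIntegrable _ _

/-- Partial sums of the cosine series. -/
def partialSum (hα : α ≤ 1) (n : ℕ) : EvenHolder α →L[ℝ] EvenHolder α :=
  ∑ j ∈ Finset.range (n + 1), modeProj hα j

/-- Sums of the first `n + 1` partial sums, that is, `n + 1` times the Fejér mean. -/
def fejerSum (hα : α ≤ 1) (n : ℕ) : EvenHolder α →L[ℝ] EvenHolder α :=
  ∑ i ∈ Finset.range (n + 1), partialSum hα i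

/-- `n + 1` times the Fejér kernel. -/
def fejerKernel (n : ℕ) (s : ℝ) : ℝ :=
  ∑ i ∈ Finset.range (n + 1), ∑ j ∈ Finset.range (i + 1), freqWeight j * Real.cos (j * s)

theorem continuous_fejerKernel (n : ℕ) : Continuous (fejerKernel n) := by
  unfold fejerKernel; fun_prop

theorem sum_freqWeight_mul_cos (n : ℕ) (s : ℝ) :
    ∑ j ∈ Finset.range (n + 1), freqWeight j * Real.cos (j * s) =
      1 + 2 * ∑ j ∈ Finset.range n, Real.cos ((n * s) - j * s) := by
  rw [Finset.sum_range_succ', ← Finset.sum_range_reflect (fun j => Real.cos (n * s - j * s)),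
    Finset.mul_sum, add_comm]
  congr 1
  · simp [freqWeight]
  · refine Finset.sum_congr rfl fun j hj => ?_
    have hj := Finset.mem_range.1 hj
    have : ((n - 1 - j : ℕ) : ℝ) = n - 1 - j := by
      rw [Nat.sub_sub, Nat.cast_sub (by omega)]; push_cast; ring
    rw [this, freqWeight, if_neg j.succ_ne_zero]
    congr 2
    push_cast; ring

theorem fejerKernel_eq (n : ℕ) (s : ℝ) :
    fejerKernel n s = (∑ j ∈ Finset.range (n + 1), Real.cos (j * s)) ^ 2 +
      (∑ j ∈ Finset.range (n + 1), Real.sin (j * s)) ^ 2 := by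
  induction n with
  | zero => simp [fejerKernel, freqWeight]
  | succ n ih =>
    have hstep : fejerKernel (n + 1) s = fejerKernel n s +
        ∑ j ∈ Finset.range (n + 1 + 1), freqWeight j * Real.cos (j * s) := by
      unfold fejerKernel; rw [Finset.sum_range_succ _ (n + 1)]
    rw [hstep, ih, sum_freqWeight_mul_cos,
      Finset.sum_range_succ (fun j : ℕ => Real.cos (j * s)) (n + 1),
      Finset.sum_range_succ (fun j : ℕ => Real.sin (j * s)) (n + 1)]
    simp only [Real.cos_sub, Finset.sum_add_distrib, ← Finset.mul_sum]
    linear_combination - Real.sin_sq_add_cos_sq (((n + 1 : ℕ) : ℝ) * s)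

theorem fejerKernel_nonneg (n : ℕ) (s : ℝ) : 0 ≤ fejerKernel n s := by
  rw [fejerKernel_eq]; positivity

theorem fejerSum_eq_integral (hα : α ≤ 1) (n : ℕ) (f : EvenHolder α) (x : ℝ) :
    fejerSum hα n f x =
      (2 * Real.pi)⁻¹ * ∫ s in (-Real.pi)..Real.pi, f (x - s) * fejerKernel n s := by
  have hc : ∀ j : ℕ, IntervalIntegrable (fun s => f (x - s) * (freqWeight j * Real.cos (j * s)))
      MeasureTheory.volume (-Real.pi) Real.pi := fun j =>
    ((f.continuous.comp (by fun_prop)).mul (by fun_prop)).intervalIntegrable _ _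
  have hS : ∀ i : ℕ, IntervalIntegrable (fun s => ∑ j ∈ Finset.range (i + 1),
      f (x - s) * (freqWeight j * Real.cos (j * s)))
      MeasureTheory.volume (-Real.pi) Real.pi := fun i =>
    (continuous_finsetSum _ fun j _ =>
      ((f.continuous.comp (by fun_prop)).mul (by fun_prop))).intervalIntegrable _ _
  simp only [fejerKernel, Finset.mul_sum]
  rw [intervalIntegral.integral_finsetSum fun i _ => hS i, Finset.mul_sum]
  simp only [fejerSum, partialSum, _root_.sum_apply, sum_apply]
  refine Finset.sum_congr rfl fun i _ => ?_
  rw [intervalIntegral.integral_finsetSum fun j _ => hc j, Finset.mul_sum]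
  exact Finset.sum_congr rfl fun j _ => modeProj_eq_integral hα j f x

theorem integral_fejerKernel (n : ℕ) :
    ∫ s in (-Real.pi)..Real.pi, fejerKernel n s = 2 * Real.pi * (n + 1) := by
  have hj : ∀ j : ℕ, ∫ s in (-Real.pi)..Real.pi, freqWeight j * Real.cos (j * s) =
      if j = 0 then 2 * Real.pi else 0 := fun j => by
    have := integral_cos_int_mul j
    rw [Int.cast_natCast] at this
    rw [intervalIntegral.integral_const_mul, this]
    rcases eq_or_ne j 0 with rfl | h <;> simp [freqWeight, *]
  unfold fejerKernel
  rw [intervalIntegral.integral_finsetSum fun i _ =>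
    (by fun_prop : Continuous _).intervalIntegrable _ _]
  have : ∀ i : ℕ, ∫ s in (-Real.pi)..Real.pi,
      ∑ j ∈ Finset.range (i + 1), freqWeight j * Real.cos (j * s) = 2 * Real.pi := fun i => by
    rw [intervalIntegral.integral_finsetSum fun j _ =>
      (by fun_prop : Continuous _).intervalIntegrable _ _]
    simp [hj]
  simp only [this, Finset.sum_const, Finset.card_range, nsmul_eq_mul]
  push_cast; ring

theorem abs_integral_mul_fejerKernel_le {g : ℝ → ℝ} {C : ℝ} (hC : ∀ s, |g s| ≤ C) (n : ℕ) :
    |(2 * Real.pi)⁻¹ * ∫ s in (-Real.pi)..Real.pi, g s * fejerKernel n s| ≤ C * (n + 1) := by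
  have h := intervalIntegral.norm_integral_le_of_norm_le (a := -Real.pi) (b := Real.pi)
    (μ := MeasureTheory.volume)
    (f := fun s => g s * fejerKernel n s) (g := fun s => C * fejerKernel n s)
    (by linarith [Real.pi_pos])
    (Eventually.of_forall fun s _ => by
      rw [norm_mul, Real.norm_of_nonneg (fejerKernel_nonneg n s)]
      exact mul_le_mul_of_nonneg_right (hC s) (fejerKernel_nonneg n s))
    ((continuous_const.mul (continuous_fejerKernel n)).intervalIntegrable _ _)
  rw [intervalIntegral.integral_const_mul, integral_fejerKernel] at h
  rw [abs_mul, abs_of_pos (inv_pos.2 Real.two_pi_pos), inv_mul_le_iff₀ Real.two_pi_pos]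
  exact h.trans_eq (by ring)

theorem norm_fejerSum_le (hα : α ≤ 1) (n : ℕ) : ‖fejerSum hα n‖ ≤ n + 1 := by
  refine ContinuousLinearMap.opNorm_le_bound _ (by positivity) fun f => ?_
  have hc : ∀ x, IntervalIntegrable (fun s => f (x - s) * fejerKernel n s)
      MeasureTheory.volume (-Real.pi) Real.pi := fun x =>
    ((f.continuous.comp (by fun_prop)).mul (continuous_fejerKernel n)).intervalIntegrable _ _
  refine (norm_le (M := ‖f.toBCF‖ * (n + 1)) (C := f.seminorm * (n + 1)) (fun x => ?_)
    fun x y => ?_).trans_eq (by rw [norm_eq]; ring)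
  · rw [fejerSum_eq_integral]
    exact abs_integral_mul_fejerKernel_le (fun s => f.abs_apply_le_norm_toBCF _) n
  · rw [fejerSum_eq_integral, fejerSum_eq_integral, ← mul_sub,
      ← intervalIntegral.integral_sub (hc x) (hc y)]
    simp only [← sub_mul]
    refine (abs_integral_mul_fejerKernel_le (C := f.seminorm * |x - y| ^ (α : ℝ))
      (fun s => ?_) n).trans_eq (by ring)
    simpa using f.abs_sub_le (x - s) (y - s)

end

/-- Sequences to which Abel summation against Fejér sums applies: null sequences with
`(n + 1) (m n - m (n + 1)) → 0` whose second differences are summable with weight `n + 1`. -/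
structure QuasiConvexNull (m : ℕ → ℝ) : Prop where
  tendsto_zero : Tendsto m atTop (𝓝 0)
  tendsto_diff : Tendsto (fun n : ℕ => (n + 1 : ℝ) * (m n - m (n + 1))) atTop (𝓝 0)
  summable : Summable fun n : ℕ => (n + 1 : ℝ) * |m n - 2 * m (n + 1) + m (n + 2)|

namespace QuasiConvexNull

theorem add {m m' : ℕ → ℝ} (h : QuasiConvexNull m) (h' : QuasiConvexNull m') :
    QuasiConvexNull fun n => m n + m' n where
  tendsto_zero := by simpa using h.tendsto_zero.add h'.tendsto_zero
  tendsto_diff := by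
    have := h.tendsto_diff.add h'.tendsto_diff
    rw [add_zero] at this
    exact this.congr fun n => by ring
  summable := by
    refine Summable.of_nonneg_of_le (fun n => by positivity) (fun n => ?_)
      (h.summable.add h'.summable)
    rw [← mul_add]
    gcongr
    refine le_trans (le_of_eq ?_) (abs_add_le _ _)
    ring_nf

theorem of_shift {m : ℕ → ℝ} (h : QuasiConvexNull fun n => m (n + 1)) : QuasiConvexNull m where
  tendsto_zero := (tendsto_add_atTop_iff_nat 1).1 h.tendsto_zero
  tendsto_diff := by
    rw [← tendsto_add_atTop_iff_nat 1]
    have h1 := h.tendsto_diff.add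
      (h.tendsto_zero.sub ((tendsto_add_atTop_iff_nat 1).2 h.tendsto_zero))
    simp only [sub_zero, add_zero] at h1
    refine h1.congr fun n => ?_
    push_cast; ring
  summable := by
    rw [← summable_nat_add_iff 1]
    refine Summable.of_nonneg_of_le (fun n => by positivity) (fun n => ?_) (h.summable.mul_left 2)
    rw [← mul_assoc]
    push_cast
    have : (n : ℝ) + 1 + 1 ≤ 2 * (n + 1) := by linarith [n.cast_nonneg (α := ℝ)]
    exact mul_le_mul_of_nonneg_right this (abs_nonneg _)

theorem of_summable {c : ℕ → ℝ} (h : Summable fun n : ℕ => (n + 1 : ℝ) * |c n|) :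
    QuasiConvexNull c := by
  have h0 : Tendsto (fun n : ℕ => (n + 1 : ℝ) * c n) atTop (𝓝 0) := by
    rw [tendsto_zero_iff_abs_tendsto_zero]
    refine h.tendsto_atTop_zero.congr fun n => ?_
    simp [abs_mul, abs_of_nonneg (by positivity : (0 : ℝ) ≤ n + 1)]
  have hc : Tendsto c atTop (𝓝 0) := by
    refine squeeze_zero_norm (fun n => ?_) h.tendsto_atTop_zero
    rw [Real.norm_eq_abs]
    exact le_mul_of_one_le_left (abs_nonneg _) (by linarith [n.cast_nonneg (α := ℝ)])
  have h1 := (summable_nat_add_iff 1).2 h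
  have h2 := (summable_nat_add_iff 2).2 h
  refine ⟨hc, ?_, ?_⟩
  · have := (h0.sub ((tendsto_add_atTop_iff_nat 1).2 h0)).add ((tendsto_add_atTop_iff_nat 1).2 hc)
    simp only [sub_zero, add_zero] at this
    refine this.congr fun n => ?_
    push_cast; ring
  · refine Summable.of_nonneg_of_le (fun n => by positivity) (fun n => ?_)
      ((h.add (h1.mul_left 2)).add h2)
    push_cast
    have e : |c n - 2 * c (n + 1) + c (n + 2)| ≤ |c n| + 2 * |c (n + 1)| + |c (n + 2)| := by
      refine (abs_add_le _ _).trans ?_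
      have := abs_sub (c n) (2 * c (n + 1))
      rw [abs_mul, abs_two] at this
      linarith
    have p : (0 : ℝ) ≤ n + 1 := by positivity
    nlinarith [mul_le_mul_of_nonneg_left e p, abs_nonneg (c (n + 1)), abs_nonneg (c (n + 2))]

theorem of_antitone_diff {b : ℕ → ℝ} (hb : Tendsto b atTop (𝓝 0))
    (hanti : Antitone fun n => b n - b (n + 1))
    (hdiff : Tendsto (fun n : ℕ => (n + 1 : ℝ) * (b n - b (n + 1))) atTop (𝓝 0)) :
    QuasiConvexNull b := by
  have hd : ∀ n, 0 ≤ b n - 2 * b (n + 1) + b (n + 2) := fun n => by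
    have := hanti n.le_succ
    simp only [Nat.succ_eq_add_one, add_assoc, one_add_one_eq_two] at this
    linarith
  have hnn : ∀ n, 0 ≤ b n - b (n + 1) := fun n => by
    refine hanti.le_of_tendsto ?_ n
    simpa using hb.sub ((tendsto_add_atTop_iff_nat 1).2 hb)
  have hb0 : ∀ n, 0 ≤ b n := fun n => (antitone_nat_of_succ_le fun n => by
    linarith [hnn n]).le_of_tendsto hb n
  refine ⟨hb, hdiff, ?_⟩
  refine summable_of_sum_range_le (c := b 0) (fun n => by positivity) fun N => ?_
  have key : ∀ N : ℕ, ∑ n ∈ Finset.range N, (n + 1 : ℝ) * |b n - 2 * b (n + 1) + b (n + 2)| =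
      b 0 - b N - N * (b N - b (N + 1)) := fun N => by
    induction N with
    | zero => simp
    | succ N ih =>
      rw [Finset.sum_range_succ, ih, abs_of_nonneg (hd N)]
      push_cast; ring
  rw [key]
  have := mul_nonneg N.cast_nonneg (hnn N)
  linarith [hb0 N]

theorem inv_sqrt : QuasiConvexNull fun n : ℕ => (Real.sqrt (n + 1))⁻¹ := by
  have hpos : ∀ n : ℕ, 0 < Real.sqrt (n + 1) := fun n => Real.sqrt_pos.2 (by positivity)
  have hsq : ∀ n : ℕ, Real.sqrt (n + 1) ^ 2 = n + 1 := fun n => Real.sq_sqrt (by positivity)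
  have hmono : Monotone fun n : ℕ => Real.sqrt (n + 1) := fun a b h =>
    Real.sqrt_le_sqrt (by gcongr)
  have hform : ∀ n : ℕ, (Real.sqrt (n + 1))⁻¹ - (Real.sqrt ((n + 1 : ℕ) + 1))⁻¹ =
      (Real.sqrt (n + 1) * Real.sqrt ((n + 1 : ℕ) + 1) *
        (Real.sqrt (n + 1) + Real.sqrt ((n + 1 : ℕ) + 1)))⁻¹ := fun n => by
    have h1 := hpos n
    have h2 := hpos (n + 1)
    have h3 := hsq n
    have h4 := hsq (n + 1)
    push_cast at *
    field_simp
    linear_combination h4 - h3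
  have hb : Tendsto (fun n : ℕ => (Real.sqrt (n + 1))⁻¹) atTop (𝓝 0) :=
    tendsto_inv_atTop_zero.comp (Real.tendsto_sqrt_atTop.comp
      (tendsto_atTop_add_const_right _ _ tendsto_natCast_atTop_atTop))
  refine of_antitone_diff hb (fun a b h => ?_) ?_
  · simp only [hform]
    have h1 := hmono h
    have h2 := hmono (Nat.succ_le_succ h)
    simp only [Nat.succ_eq_add_one] at h1 h2
    have := hpos a
    have := hpos (a + 1)
    gcongr
  · refine squeeze_zero (fun n => ?_) (fun n => ?_) hb
    · rw [hform]; positivity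
    · rw [hform]
      have h1 := hpos n
      have h2 : Real.sqrt (n + 1) ≤ Real.sqrt ((n + 1 : ℕ) + 1) := hmono n.le_succ
      have h3 := hsq n
      have h4 : (n + 1 : ℝ) * Real.sqrt (n + 1) ≤ Real.sqrt (n + 1) * Real.sqrt ((n + 1 : ℕ) + 1) *
        (Real.sqrt (n + 1) + Real.sqrt ((n + 1 : ℕ) + 1)) := by
        calc _ = Real.sqrt (n + 1) * Real.sqrt (n + 1) * Real.sqrt (n + 1) := by
              rw [← sq, h3]
          _ ≤ _ := by gcongr; linarith
      rw [← div_eq_mul_inv, ← one_div, div_le_div_iff₀ (by positivity) h1, one_mul]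
      exact h4

end QuasiConvexNull

theorem symbol_zero : symbol 0 = 1 := if_pos rfl

theorem symbol_natCast {k : ℕ} (hk : k ≠ 0) : symbol k = Real.sqrt (Real.tanh k / k) :=
  if_neg (by exact_mod_cast hk)

theorem symbol_eq_muStar {k : ℕ} (hk : k ≠ 0) : symbol k = muStar k := symbol_natCast hk

theorem one_sub_two_mul_exp_le_tanh (x : ℝ) : 1 - 2 * Real.exp (-(2 * x)) ≤ Real.tanh x := by
  rw [Real.tanh_eq, le_div_iff₀ (by positivity)]
  have h : Real.exp (-(2 * x)) * Real.exp x = Real.exp (-x) := by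
    rw [← Real.exp_add]; ring_nf
  nlinarith [mul_pos (Real.exp_pos (-(2 * x))) (Real.exp_pos (-x))]

theorem div_add_one_lt_tanh {x : ℝ} (hx : 0 < x) : x / (x + 1) < Real.tanh x := by
  have h1 : 2 * x + 1 < Real.exp (2 * x) := Real.add_one_lt_exp (by positivity)
  have h : Real.exp (2 * x) * Real.exp (-x) = Real.exp x := by
    rw [← Real.exp_add]; ring_nf
  rw [Real.tanh_eq, div_lt_div_iff₀ (by positivity) (by positivity)]
  nlinarith [Real.exp_pos (-x)]

theorem tanh_pos {x : ℝ} (hx : 0 < x) : 0 < Real.tanh x :=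
  lt_trans (by positivity) (div_add_one_lt_tanh hx)

theorem muStar_pos {k : ℕ} (hk : k ≠ 0) : 0 < muStar k := by
  have : (0 : ℝ) < k := by positivity
  exact Real.sqrt_pos.2 (div_pos (tanh_pos this) this)

theorem muStar_lt_one {k : ℕ} (hk : k ≠ 0) : muStar k < 1 := by
  have h0 : (1 : ℝ) ≤ k := by exact_mod_cast Nat.pos_of_ne_zero hk
  rw [muStar, Real.sqrt_lt' one_pos, one_pow, div_lt_one (by positivity)]
  exact (Real.tanh_lt_one _).trans_le h0

theorem muStar_strictAnti {j k : ℕ} (hj : j ≠ 0) (hjk : j < k) : muStar k < muStar j := by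
  have hj' : (0 : ℝ) < j := by positivity
  have hk' : (j : ℝ) + 1 ≤ k := by exact_mod_cast hjk
  have hk0 : (0 : ℝ) < k := by linarith
  have h1 := div_add_one_lt_tanh hj'
  rw [div_lt_iff₀ (by positivity)] at h1
  have h2 := Real.tanh_lt_one (k : ℝ)
  refine Real.sqrt_lt_sqrt (div_pos (tanh_pos hk0) hk0).le ?_
  rw [div_lt_div_iff₀ hk0 hj']
  nlinarith [tanh_pos hj']

theorem symbol_strictAnti : StrictAnti fun k : ℕ => symbol k :=
  strictAnti_nat_of_succ_lt fun j => by
    rw [symbol_eq_muStar j.succ_ne_zero]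
    rcases eq_or_ne j 0 with rfl | hj
    · rw [Nat.cast_zero, symbol_zero]; exact muStar_lt_one (by omega)
    · rw [symbol_eq_muStar hj]; exact muStar_strictAnti hj j.lt_succ_self

theorem symbol_nonneg (x : ℝ) : 0 ≤ symbol x := by
  unfold symbol; split_ifs
  · exact zero_le_one
  · exact Real.sqrt_nonneg _

theorem symbol_le_inv_sqrt {k : ℕ} (hk : k ≠ 0) : symbol k ≤ (Real.sqrt k)⁻¹ := by
  have : (0 : ℝ) < k := by positivity
  rw [symbol_natCast hk, ← Real.sqrt_inv]
  refine Real.sqrt_le_sqrt ?_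
  rw [← one_div]
  gcongr
  exact (Real.tanh_lt_one _).le

theorem quasiConvexNull_symbol : QuasiConvexNull fun k : ℕ => symbol k := by
  refine QuasiConvexNull.of_shift ?_
  have hc : QuasiConvexNull fun n : ℕ => symbol (n + 1 : ℕ) - (Real.sqrt (n + 1))⁻¹ := by
    refine QuasiConvexNull.of_summable ?_
    have hr : ‖Real.exp (-2)‖ < 1 := by
      rw [Real.norm_eq_abs, Real.abs_exp, Real.exp_lt_one_iff]; norm_num
    have hs : Summable fun n : ℕ => (n + 1 : ℝ) * Real.exp (-2) ^ n := by
      have h1 := summable_pow_mul_geometric_of_norm_lt_one 1 hr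
      have h2 := summable_geometric_of_norm_lt_one hr
      exact (h1.add h2).congr fun n => by simp; ring
    refine Summable.of_nonneg_of_le (fun n => by positivity) (fun n => ?_) (hs.mul_left 2)
    set x : ℝ := n + 1 with hx
    have hx1 : 1 ≤ x := by simp [hx]
    have ht := tanh_pos (zero_lt_one.trans_le hx1)
    have hle : 1 - Real.sqrt (Real.tanh x) ≤ 2 * Real.exp (-2) ^ n := by
      have h1 : Real.tanh x ≤ Real.sqrt (Real.tanh x) :=
        Real.le_sqrt_of_sq_le (by nlinarith [Real.tanh_lt_one x])
      have h2 := one_sub_two_mul_exp_le_tanh x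
      have h3 : Real.exp (-(2 * x)) ≤ Real.exp (-2) ^ n := by
        rw [← Real.exp_nat_mul]
        exact Real.exp_le_exp.2 (by rw [hx]; linarith)
      linarith
    have h0 : Real.sqrt (Real.tanh x) ≤ 1 := Real.sqrt_le_one.2 (Real.tanh_lt_one x).le
    have hsq : 1 ≤ Real.sqrt x := Real.one_le_sqrt.2 hx1
    have heq : symbol (n + 1 : ℕ) = Real.sqrt (Real.tanh x) * (Real.sqrt x)⁻¹ := by
      rw [symbol_natCast n.succ_ne_zero, show ((n.succ : ℕ) : ℝ) = x by simp [hx],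
        Real.sqrt_div ht.le, div_eq_mul_inv]
    have habs : |symbol (n + 1 : ℕ) - (Real.sqrt x)⁻¹| ≤ 2 * Real.exp (-2) ^ n := by
      rw [heq, ← sub_one_mul, abs_mul, abs_sub_comm, abs_of_nonneg (by linarith),
        abs_of_nonneg (by positivity)]
      calc _ ≤ (1 - Real.sqrt (Real.tanh x)) * 1 := by
            exact mul_le_mul_of_nonneg_left (inv_le_one_of_one_le₀ hsq) (by linarith)
        _ ≤ _ := by rwa [mul_one]
    calc _ ≤ x * (2 * Real.exp (-2) ^ n) := by gcongr
      _ = _ := by ring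
  simpa using hc.add QuasiConvexNull.inv_sqrt

section

open EvenHolder

variable {α : ℝ≥0}

/-- Summation by parts, twice. -/
theorem sum_smul_eq_sum_second_diff {E : Type*} [AddCommGroup E] [Module ℝ E] (m : ℕ → ℝ)
    (p : ℕ → E) (N : ℕ) :
    ∑ j ∈ Finset.range (N + 2), m j • p j =
      ∑ n ∈ Finset.range N, (m n - 2 * m (n + 1) + m (n + 2)) •
          ∑ i ∈ Finset.range (n + 1), ∑ j ∈ Finset.range (i + 1), p j +
        (m N - m (N + 1)) • ∑ i ∈ Finset.range (N + 1), ∑ j ∈ Finset.range (i + 1), p j +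
        m (N + 1) • ∑ j ∈ Finset.range (N + 2), p j := by
  set D : ℕ → E := fun i => ∑ j ∈ Finset.range (i + 1), p j with hD
  have hD0 : D 0 = p 0 := by simp [hD]
  have hDs : ∀ i, D (i + 1) = D i + p (i + 1) := fun i => Finset.sum_range_succ p (i + 1)
  change _ = ∑ n ∈ Finset.range N, _ • ∑ i ∈ Finset.range (n + 1), D i +
    _ • ∑ i ∈ Finset.range (N + 1), D i + m (N + 1) • D (N + 1)
  clear_value D
  induction N with
  | zero =>
    rw [hDs]
    simp [Finset.sum_range_succ, hD0]
    module
  | succ N ih =>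
    rw [Finset.sum_range_succ _ (N + 2), ih,
      Finset.sum_range_succ (fun n => (m n - 2 * m (n + 1) + m (n + 2)) • _) N,
      Finset.sum_range_succ D (N + 1), hDs (N + 1)]
    simp only [add_assoc, Nat.reduceAdd]
    module

theorem tendsto_antitone_mul_sum {m a : ℕ → ℝ} (hm : Antitone m) (hm0 : Tendsto m atTop (𝓝 0))
    (h : Summable fun j => |a j| * m j) :
    Tendsto (fun N => m N * ∑ j ∈ Finset.range (N + 1), a j) atTop (𝓝 0) := by
  have hnn : ∀ n, 0 ≤ m n := hm.le_of_tendsto hm0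
  have key := tendsto_tsum_of_dominated_convergence (𝓕 := atTop)
    (f := fun N j => if j < N + 1 then m N * a j else 0) (g := fun _ => (0 : ℝ)) h
    (fun j => by
      refine Tendsto.congr' (f₁ := fun N => m N * a j) ?_ (by simpa using hm0.mul_const (a j))
      filter_upwards [eventually_ge_atTop j] with N hN
      rw [if_pos (by omega)])
    (Eventually.of_forall fun N j => by
      split_ifs with hj
      · rw [norm_mul, Real.norm_of_nonneg (hnn N), mul_comm]
        exact mul_le_mul_of_nonneg_left (hm (by omega)) (abs_nonneg _)
      · simpa using mul_nonneg (abs_nonneg (a j)) (hnn j))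
  rw [tsum_zero] at key
  refine key.congr fun N => ?_
  rw [tsum_eq_sum (s := Finset.range (N + 1)) fun j hj => if_neg (by simpa using hj),
    Finset.mul_sum]
  exact Finset.sum_congr rfl fun j hj => if_pos (Finset.mem_range.1 hj)

theorem summable_abs_cosCoeff_mul_symbol (hα : 1 / 2 < α) (f : EvenHolder α) :
    Summable fun k : ℕ => |cosCoeff f k| * symbol k := by
  have hα' : (1 / 2 : ℝ) < α := by exact_mod_cast hα
  have hs : Summable fun k : ℕ => (k : ℝ) ^ (-((α : ℝ) + 1 / 2)) :=
    Real.summable_nat_rpow.2 (by linarith)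
  refine Summable.of_norm_bounded_eventually_nat (hs.mul_left (f.seminorm * Real.pi ^ (α : ℝ))) ?_
  filter_upwards [eventually_ge_atTop 1] with k hk
  have hk0 : (0 : ℝ) < k := by exact_mod_cast hk
  have hk1 : k ≠ 0 := by omega
  rw [Real.norm_of_nonneg (mul_nonneg (abs_nonneg _) (symbol_nonneg _))]
  calc _ ≤ f.seminorm * (Real.pi / k) ^ (α : ℝ) * (Real.sqrt k)⁻¹ :=
        mul_le_mul (abs_cosCoeff_le f hk1) (symbol_le_inv_sqrt hk1) (symbol_nonneg _)
          (mul_nonneg f.seminorm_nonneg (by positivity))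
    _ = _ := by
        rw [Real.div_rpow Real.pi_pos.le hk0.le, Real.sqrt_eq_rpow, ← Real.rpow_neg hk0.le, neg_add,
          Real.rpow_add hk0, Real.rpow_neg hk0.le (α : ℝ)]
        ring

/-- The operator `L` on `C^α_even(𝕊)`, as an absolutely convergent series of Fejér sums. -/
def whithamCLM (hα : α ≤ 1) : EvenHolder α →L[ℝ] EvenHolder α :=
  ∑' n : ℕ, (symbol n - 2 * symbol (n + 1 : ℕ) + symbol (n + 2 : ℕ)) • fejerSum hα n

theorem hasSum_whithamCLM (hα : α ≤ 1) :
    HasSum (fun n : ℕ => (symbol n - 2 * symbol (n + 1 : ℕ) + symbol (n + 2 : ℕ)) • fejerSum hα n)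
      (whithamCLM hα) := by
  refine Summable.hasSum (Summable.of_norm_bounded quasiConvexNull_symbol.summable fun n => ?_)
  rw [norm_smul, mul_comm]
  exact mul_le_mul_of_nonneg_right (norm_fejerSum_le hα n) (norm_nonneg _)

theorem isCompactOperator_modeProj (hα : α ≤ 1) (k : ℕ) : IsCompactOperator (modeProj hα k) :=
  (isCompactOperator_of_locallyCompactSpace_dom (coeffCLM (α := α) k)).clm_comp
    (ContinuousLinearMap.toSpanSingleton ℝ (cosMode hα k))

theorem isCompactOperator_whithamCLM (hα : α ≤ 1) : IsCompactOperator (whithamCLM hα) := by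
  refine isCompactOperator_of_tendsto (hasSum_whithamCLM hα) (Eventually.of_forall fun s => ?_)
  change _ ∈ compactOperator (RingHom.id ℝ) (EvenHolder α) (EvenHolder α)
  refine Submodule.sum_mem _ fun n _ => Submodule.smul_mem _ _ ?_
  exact Submodule.sum_mem _ fun i _ => Submodule.sum_mem _ fun j _ => isCompactOperator_modeProj hα j

theorem tendsto_functional_whithamCLM (hα : α ≤ 1) (l : EvenHolder α →L[ℝ] ℝ) (f : EvenHolder α) :
    Tendsto (fun N : ℕ => ∑ j ∈ Finset.range (N + 2), symbol j * l (modeProj hα j f) -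
      symbol (N + 1 : ℕ) * ∑ j ∈ Finset.range (N + 2), l (modeProj hα j f)) atTop
      (𝓝 (l (whithamCLM hα f))) := by
  have hcont : Continuous fun Q : EvenHolder α →L[ℝ] EvenHolder α => l (Q f) := by fun_prop
  have h1 := (hcont.tendsto _).comp (hasSum_whithamCLM hα).tendsto_sum_nat
  have h2 : Tendsto (fun N : ℕ => (symbol N - symbol (N + 1 : ℕ)) * l (fejerSum hα N f)) atTop
      (𝓝 0) := by
    have h3 := quasiConvexNull_symbol.tendsto_diff.abs.mul_const (‖l‖ * ‖f‖)
    rw [abs_zero, zero_mul] at h3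
    refine squeeze_zero_norm (fun N => ?_) h3
    have h4 : ‖l (fejerSum hα N f)‖ ≤ ‖l‖ * ((N + 1) * ‖f‖) :=
      (l.le_opNorm _).trans (by
        gcongr; exact (fejerSum hα N).le_of_opNorm_le (norm_fejerSum_le hα N) f)
    rw [norm_mul, abs_mul, abs_of_nonneg (by positivity : (0 : ℝ) ≤ N + 1), Real.norm_eq_abs]
    calc _ ≤ |symbol N - symbol (N + 1 : ℕ)| * (‖l‖ * ((N + 1) * ‖f‖)) := by gcongr
      _ = _ := by ring
  have h5 := h1.add h2
  rw [add_zero] at h5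
  refine h5.congr fun N => ?_
  have h6 := congrArg (fun Q : EvenHolder α →L[ℝ] EvenHolder α => l (Q f))
    (sum_smul_eq_sum_second_diff (fun k : ℕ => symbol k) (modeProj hα) N)
  simp only [_root_.sum_apply, _root_.add_apply, _root_.smul_apply,
    map_sum, map_add, map_smul, smul_eq_mul] at h6
  simp only [Function.comp_apply, fejerSum, partialSum, _root_.sum_apply,
    _root_.smul_apply, map_sum, map_smul, smul_eq_mul]
  linarith

theorem whithamCLM_apply (hα : 1 / 2 < α) (hα' : α ≤ 1) (f : EvenHolder α) (x : ℝ) :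
    whithamCLM hα' f x = L f x := by
  have hs := summable_abs_cosCoeff_mul_symbol hα f
  have hbd : ∀ j : ℕ, |cosCoeff f j * Real.cos (j * x)| ≤ |cosCoeff f j| := fun j => by
    rw [abs_mul]
    exact mul_le_of_le_one_right (abs_nonneg _) (Real.abs_cos_le_one _)
  have hs1 : Summable fun j : ℕ => |cosCoeff f j * Real.cos (j * x)| * symbol j :=
    hs.of_nonneg_of_le (fun j => mul_nonneg (abs_nonneg _) (symbol_nonneg _))
      fun j => mul_le_mul_of_nonneg_right (hbd j) (symbol_nonneg _)
  have hs2 : Summable fun j : ℕ => cosCoeff f j * symbol j * Real.cos (j * x) := by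
    refine Summable.of_norm (hs1.congr fun j => ?_)
    simp only [Real.norm_eq_abs, abs_mul, abs_of_nonneg (symbol_nonneg j)]
    ring
  have h1 := tendsto_functional_whithamCLM hα' (evalCLM x) f
  simp only [evalCLM_apply, modeProj_apply_apply] at h1
  have h2 := (tendsto_add_atTop_iff_nat 1).2
    (tendsto_antitone_mul_sum symbol_strictAnti.antitone quasiConvexNull_symbol.tendsto_zero hs1)
  have h3 := h1.add h2
  rw [add_zero] at h3
  refine tendsto_nhds_unique h3 (((tendsto_add_atTop_iff_nat 2).2
    hs2.hasSum.tendsto_sum_nat).congr fun N => ?_)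
  rw [sub_add_cancel]
  exact Finset.sum_congr rfl fun j _ => by ring

theorem cosCoeff_whithamCLM (hα : α ≤ 1) (f : EvenHolder α) (k : ℕ) :
    cosCoeff (whithamCLM hα f) k = symbol k * cosCoeff f k := by
  have h1 := tendsto_functional_whithamCLM hα (coeffCLM k) f
  have h2 := ((tendsto_add_atTop_iff_nat 1).2 quasiConvexNull_symbol.tendsto_zero).mul_const
    (cosCoeff f k)
  have h3 := h1.add h2
  rw [zero_mul, add_zero] at h3
  refine tendsto_nhds_unique h3 (tendsto_const_nhds.congr' ?_)
  filter_upwards [eventually_ge_atTop k] with N hN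
  have hproj : ∀ j, coeffCLM k (modeProj hα j f) = if j = k then cosCoeff f k else 0 := fun j => by
    rw [modeProj_apply, map_smul, coeffCLM_apply, cosCoeff_cosMode]
    split_ifs with h
    · subst h; simp
    · simp
  have hk : k ∈ Finset.range (N + 2) := Finset.mem_range.2 (by omega)
  simp only [hproj, mul_ite, mul_zero, Finset.sum_ite_eq', hk, if_true]
  ring

end

section SimpleEigenvalue

variable {A : Type*} [NormedCommRing A] [NormedAlgebra ℝ A]

/-- The linearization `(v, ν) ↦ (μ v - L v + ν e, a v)` of the bifurcation problem
`μ u - L u = ε u²`, `a u = 1` at `ε = 0`, `u = e`. -/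
def linearized (L : A →L[ℝ] A) (a : A →L[ℝ] ℝ) (e : A) (μ : ℝ) : A × ℝ →L[ℝ] A × ℝ :=
  (μ • ContinuousLinearMap.fst ℝ A ℝ - L.comp (ContinuousLinearMap.fst ℝ A ℝ) +
    (ContinuousLinearMap.snd ℝ A ℝ).smulRight e).prod (a.comp (ContinuousLinearMap.fst ℝ A ℝ))

@[simp] theorem linearized_apply (L : A →L[ℝ] A) (a : A →L[ℝ] ℝ) (e : A) (μ : ℝ) (p : A × ℝ) :
    linearized L a e μ p = (μ • p.1 - L p.1 + p.2 • e, a p.1) := rfl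

theorem linearized_bijective [CompleteSpace A] {L : A →L[ℝ] A} {a : A →L[ℝ] ℝ} {e : A} {μ : ℝ}
    (hL : IsCompactOperator L) (hμ : μ ≠ 0) (hae : a e = 1) (haL : ∀ v, a (L v) = μ * a v)
    (hker : ∀ v, L v = μ • v → a v = 0 → v = 0) :
    Function.Bijective (linearized L a e μ) := by
  let R : A × ℝ →L[ℝ] ℝ × ℝ :=
    (ContinuousLinearMap.snd ℝ A ℝ).prod (a.comp (ContinuousLinearMap.fst ℝ A ℝ))
  let G : ℝ × ℝ →L[ℝ] A × ℝ :=
    (-(ContinuousLinearMap.fst ℝ ℝ ℝ).smulRight e).prod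
      (μ • ContinuousLinearMap.fst ℝ ℝ ℝ - ContinuousLinearMap.snd ℝ ℝ ℝ)
  let K : A × ℝ →L[ℝ] A × ℝ :=
    (ContinuousLinearMap.inl ℝ A ℝ).comp (L.comp (ContinuousLinearMap.fst ℝ A ℝ)) + G.comp R
  have hK : IsCompactOperator K :=
    ((hL.comp_clm (ContinuousLinearMap.fst ℝ A ℝ)).clm_comp (ContinuousLinearMap.inl ℝ A ℝ)).add
      ((isCompactOperator_of_locallyCompactSpace_dom R).clm_comp G)
  have hKM : ∀ p, linearized L a e μ p = μ • p - K p := fun p => by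
    ext
    · simp [K, G, R]; abel
    · simp [K, G, R]
  rcases hK.hasEigenvalue_or_mem_resolventSet hμ with h | h
  · exfalso
    obtain ⟨⟨v, ν⟩, hv⟩ := h.exists_hasEigenvector
    refine hv.2 ?_
    have h0 : linearized L a e μ (v, ν) = 0 := by
      rw [hKM, sub_eq_zero]; exact hv.apply_eq_smul.symm
    rw [linearized_apply, Prod.mk_eq_zero] at h0
    obtain ⟨h1, h2⟩ := h0
    simp only at h1 h2
    have h3 := congrArg a h1
    simp only [map_add, map_sub, map_smul, smul_eq_mul, haL, hae, map_zero, sub_self, zero_add,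
      mul_one] at h3
    rw [h3, zero_smul, add_zero, sub_eq_zero] at h1
    rw [hker v h1.symm h2, h3]; rfl
  · rw [spectrum.mem_resolventSet_iff, ContinuousLinearMap.isUnit_iff_bijective] at h
    convert h using 1
    ext1 p
    rw [hKM]
    simp [Algebra.algebraMap_eq_smul_one]

theorem isInvertible_of_bijective {E F : Type*} [NormedAddCommGroup E] [NormedSpace ℝ E]
    [CompleteSpace E] [NormedAddCommGroup F] [NormedSpace ℝ F] [CompleteSpace F] {T : E →L[ℝ] F}
    (hT : Function.Bijective T) : T.IsInvertible :=
  ⟨ContinuousLinearEquiv.ofBijective T (LinearMap.ker_eq_bot.2 hT.1)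
    (LinearMap.range_eq_top.2 hT.2), by ext; rfl⟩

theorem exists_norm_le_mul_of_bijective {E F : Type*} [NormedAddCommGroup E] [NormedSpace ℝ E]
    [CompleteSpace E] [NormedAddCommGroup F] [NormedSpace ℝ F] [CompleteSpace F] {T : E →L[ℝ] F}
    (hT : Function.Bijective T) : ∃ C : ℝ, 0 ≤ C ∧ ∀ x, ‖x‖ ≤ C * ‖T x‖ := by
  obtain ⟨e, he⟩ := isInvertible_of_bijective hT
  refine ⟨‖(e.symm : F →L[ℝ] E)‖, norm_nonneg _, fun x => ?_⟩
  have := (e.symm : F →L[ℝ] E).le_opNorm (e x)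
  rw [ContinuousLinearEquiv.coe_coe, e.symm_apply_apply] at this
  rwa [← he]

/-- The rescaled solution set `μ u - L u = ε u²`, `a u = 1` is locally an analytic curve. -/
theorem exists_analyticAt_rescaled_curve [CompleteSpace A] {L : A →L[ℝ] A} {a : A →L[ℝ] ℝ} {e : A}
    {μ : ℝ} (hbij : Function.Bijective (linearized L a e μ)) (hLe : L e = μ • e) (hae : a e = 1) :
    ∃ ψ : ℝ → A × ℝ, AnalyticAt ℝ ψ 0 ∧ ψ 0 = (e, μ) ∧
      ∀ᶠ v in 𝓝 ((0 : ℝ), (e, μ)),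
        (v.2.2 • v.2.1 - L v.2.1 - v.1 • v.2.1 ^ 2 = 0 ∧ a v.2.1 = 1) ↔ ψ v.1 = v.2 := by
  let G : ℝ × (A × ℝ) → A × ℝ := fun v => (v.2.2 • v.2.1 - L v.2.1 - v.1 • v.2.1 ^ 2, a v.2.1)
  have hG : ContDiffAt ℝ ⊤ G (0, (e, μ)) := by
    apply ContDiff.contDiffAt
    fun_prop
  have hderiv : fderiv ℝ G (0, (e, μ)) ∘L .inr ℝ ℝ (A × ℝ) = linearized L a e μ := by
    have h1 : HasFDerivAt (fun y => G (0, y)) (fderiv ℝ G (0, (e, μ)) ∘L .inr ℝ ℝ (A × ℝ)) (e, μ) :=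
      (hG.differentiableAt (by simp)).hasFDerivAt.comp (e, μ) (hasFDerivAt_prodMk_right 0 (e, μ))
    have h2 : HasFDerivAt (fun y : A × ℝ => (y.2 • y.1 - L y.1, a y.1)) (linearized L a e μ)
        (e, μ) := by
      have h3 := (((hasFDerivAt_snd (𝕜 := ℝ) (p := (e, μ))).smul hasFDerivAt_fst).sub
        (L.hasFDerivAt.comp (e, μ) hasFDerivAt_fst)).prodMk
          (a.hasFDerivAt.comp (e, μ) hasFDerivAt_fst)
      refine h3.congr_fderiv ?_
      ext p <;> simp
    refine h1.unique (h2.congr_of_eventuallyEq (Eventually.of_forall fun y => ?_))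
    simp [G]
  have hinv : (fderiv ℝ G (0, (e, μ)) ∘L .inr ℝ ℝ (A × ℝ)).IsInvertible := by
    rw [hderiv]; exact isInvertible_of_bijective hbij
  have hG0 : G (0, (e, μ)) = (0, 1) := by simp [G, hLe, hae]
  refine ⟨hG.implicitFunction (by simp) hinv,
    (hG.contDiffAt_implicitFunction (by simp) hinv).analyticAt,
    hG.implicitFunction_apply_self (by simp) hinv, ?_⟩
  filter_upwards [hG.eventually_apply_eq_iff_implicitFunction (by simp) hinv] with v hv
  rw [← hv, hG0, Prod.mk_inj]

/-- Near `(0, μ)` every nontrivial solution, rescaled, is close to `(e, μ)`. -/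
theorem eventually_rescaled [CompleteSpace A] {L : A →L[ℝ] A} {a : A →L[ℝ] ℝ} {e : A}
    {μ : ℝ} (hbij : Function.Bijective (linearized L a e μ)) (hLe : L e = μ • e) (hae : a e = 1)
    {P : ℝ × (A × ℝ) → Prop} (hP : ∀ᶠ v in 𝓝 ((0 : ℝ), (e, μ)), P v) :
    ∀ᶠ p in 𝓝 ((0 : A), μ), p.1 ≠ 0 → p.2 • p.1 - L p.1 - p.1 ^ 2 = 0 →
      a p.1 ≠ 0 ∧ P (a p.1, ((a p.1)⁻¹ • p.1, p.2)) := by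
  obtain ⟨C, hC0, hC⟩ := exists_norm_le_mul_of_bijective hbij
  obtain ⟨r, hr, hball⟩ := Metric.eventually_nhds_iff.1 hP
  have hlt : ∀ {g : A × ℝ → ℝ} {c : ℝ}, Continuous g → g (0, μ) < c →
      ∀ᶠ p in 𝓝 ((0 : A), μ), g p < c := fun hg h => hg.continuousAt.eventually_lt_const h
  have e1 := hlt (g := fun p => C * |μ - p.2|) (c := 1 / 4) (by fun_prop) (by simp)
  have e2 := hlt (g := fun p => C * ‖p.1‖) (c := 1 / 4) (by fun_prop) (by simp)
  have e3 := hlt (g := fun p => |a p.1|) (c := r) (by fun_prop) (by simpa)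
  have e4 := hlt (g := fun p => 2 * C * ‖p.1‖ * ‖e‖) (c := r) (by fun_prop) (by simpa)
  have e5 := hlt (g := fun p => |p.2 - μ|) (c := r) (by fun_prop) (by simpa)
  filter_upwards [e1, e2, e3, e4, e5] with ⟨φ, ν⟩ h1 h2 h3 h4 h5 hφ hsol
  simp only at h1 h2 h3 h4 h5 hφ hsol ⊢
  set ε := a φ with hε
  obtain ⟨w, hw⟩ : ∃ w, w = φ - ε • e := ⟨_, rfl⟩
  have hφw : φ = ε • e + w := by rw [hw]; abel
  have hlin : linearized L a e μ (w, ε * (ν - μ)) = ((μ - ν) • w + φ ^ 2, 0) := by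
    rw [linearized_apply, Prod.mk_inj]
    constructor
    · have : φ ^ 2 = ν • φ - L φ := (sub_eq_zero.1 hsol).symm
      rw [this, hφw, map_add, map_smul, hLe]
      module
    · simp [hw, hae, hε]
  have hw1 : ‖w‖ ≤ C * (|μ - ν| * ‖w‖ + ‖φ‖ * (|ε| * ‖e‖ + ‖w‖)) := by
    calc ‖w‖ ≤ ‖(w, ε * (ν - μ))‖ := norm_fst_le (w, ε * (ν - μ))
      _ ≤ C * ‖(μ - ν) • w + φ ^ 2‖ := by
        refine (hC _).trans_eq ?_
        rw [hlin, Prod.norm_mk, norm_zero, max_eq_left (norm_nonneg _)]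
      _ ≤ _ := by
        gcongr
        refine (norm_add_le _ _).trans (add_le_add (norm_smul _ _).le ?_)
        rw [sq]
        refine (norm_mul_le _ _).trans (mul_le_mul_of_nonneg_left ?_ (norm_nonneg _))
        calc ‖φ‖ = ‖ε • e + w‖ := by rw [← hφw]
          _ ≤ ‖ε • e‖ + ‖w‖ := norm_add_le _ _
          _ = _ := by rw [norm_smul, Real.norm_eq_abs]
  have hw2 : ‖w‖ ≤ 2 * C * ‖φ‖ * ‖e‖ * |ε| := by
    nlinarith [mul_le_mul_of_nonneg_right h1.le (norm_nonneg w),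
      mul_le_mul_of_nonneg_right h2.le (norm_nonneg w)]
  have hε0 : ε ≠ 0 := fun h => by
    rw [h, abs_zero, mul_zero] at hw2
    rw [h, zero_smul, zero_add, norm_le_zero_iff.1 hw2] at hφw
    exact hφ hφw
  refine ⟨hε0, hball ?_⟩
  have hu : ε⁻¹ • φ - e = ε⁻¹ • w := by
    rw [hw, smul_sub, inv_smul_smul₀ hε0]
  rw [Prod.dist_eq, Prod.dist_eq, max_lt_iff, max_lt_iff]
  refine ⟨by simpa [Real.dist_eq] using h3, ?_, h5⟩
  change dist (ε⁻¹ • φ) e < r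
  rw [dist_eq_norm, hu, norm_smul, norm_inv, Real.norm_eq_abs]
  refine lt_of_le_of_lt ?_ h4
  rw [inv_mul_le_iff₀ (abs_pos.2 hε0)]
  linarith

/-- Analytic bifurcation from a simple eigenvalue for `μ φ - L φ = φ²`. The bifurcating solutions
lie in every algebra that `L` preserves and on which the linearization is still bijective. -/
theorem exists_bifurcation_curve [CompleteSpace A] {L : A →L[ℝ] A} {a : A →L[ℝ] ℝ} {e : A}
    {μ : ℝ} (hbij : Function.Bijective (linearized L a e μ)) (hLe : L e = μ • e) (hae : a e = 1)
    {s : Set ℝ} (hs : s ∈ 𝓝 μ)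
    {B : Type*} [NormedCommRing B] [NormedAlgebra ℝ B] [CompleteSpace B] {ι : B →ₐ[ℝ] A}
    (hι : Continuous ι) (hι' : Function.Injective ι) {LB : B →L[ℝ] B} {aB : B →L[ℝ] ℝ} {eB : B}
    (hιL : ∀ v, ι (LB v) = L (ι v)) (hιa : ∀ v, aB v = a (ι v)) (hιe : ι eB = e)
    (hbijB : Function.Bijective (linearized LB aB eB μ)) :
    ∃ (δ : ℝ) (φ : ℝ → A) (ν : ℝ → ℝ), 0 < δ ∧
      AnalyticOnNhd ℝ φ (Ioo (-δ) δ) ∧ AnalyticOnNhd ℝ ν (Ioo (-δ) δ) ∧ φ 0 = 0 ∧ ν 0 = μ ∧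
      HasDerivAt φ e 0 ∧
      (∀ ε ∈ Ioo (-δ) δ, ν ε ∈ s ∧ ν ε • φ ε - L (φ ε) - φ ε ^ 2 = 0 ∧ φ ε ∈ range ι ∧
        (ε ≠ 0 → φ ε ≠ 0)) ∧
      ∀ᶠ p in 𝓝 ((0 : A), μ), (p.1 ≠ 0 ∧ p.2 • p.1 - L p.1 - p.1 ^ 2 = 0) ↔
        ∃ ε ∈ Ioo (-δ) δ, ε ≠ 0 ∧ p = (φ ε, ν ε) := by
  obtain ⟨ψ, hψ, hψ0, hψiff⟩ := exists_analyticAt_rescaled_curve hbij hLe hae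
  have hLeB : LB eB = μ • eB := hι' (by rw [hιL, hιe, hLe, map_smul, hιe])
  obtain ⟨χ, hχ, hχ0, hχiff⟩ :=
    exists_analyticAt_rescaled_curve hbijB hLeB (by rw [hιa, hιe, hae])
  have ev_sol : ∀ᶠ ε in 𝓝 (0 : ℝ),
      (ψ ε).2 • (ψ ε).1 - L (ψ ε).1 - ε • (ψ ε).1 ^ 2 = 0 ∧ a (ψ ε).1 = 1 := by
    have ht : Tendsto (fun ε : ℝ => (ε, ψ ε)) (𝓝 0) (𝓝 (0, (e, μ))) := by
      have := (continuousAt_id.prodMk hψ.continuousAt).tendsto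
      simpa only [id, hψ0] using this
    filter_upwards [ht.eventually hψiff] with ε hε
    exact hε.2 rfl
  have ev_range : ∀ᶠ ε in 𝓝 (0 : ℝ), (ψ ε).1 ∈ range ι := by
    have ht : Tendsto (fun ε : ℝ => (ε, χ ε)) (𝓝 0) (𝓝 (0, (eB, μ))) := by
      have := (continuousAt_id.prodMk hχ.continuousAt).tendsto
      simpa only [id, hχ0] using this
    have ht' : Tendsto (fun ε : ℝ => (ε, (ι (χ ε).1, (χ ε).2))) (𝓝 0) (𝓝 (0, (e, μ))) := by
      have hc : Continuous fun v : ℝ × (B × ℝ) => (v.1, (ι v.2.1, v.2.2)) := by fun_prop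
      have := (hc.tendsto (0, (eB, μ))).comp ht
      rw [hιe] at this
      exact this
    filter_upwards [ht.eventually hχiff, ht'.eventually hψiff] with ε h1 h2
    obtain ⟨h3, h4⟩ := h1.2 rfl
    have h5 := h2.1 ⟨by
      have := congrArg ι h3
      simpa only [map_sub, map_smul, map_pow, map_zero, hιL] using this, by rw [← hιa]; exact h4⟩
    exact ⟨(χ ε).1, by rw [h5]⟩
  have ev_s : ∀ᶠ ε in 𝓝 (0 : ℝ), (ψ ε).2 ∈ s := by
    have : Tendsto (fun ε => (ψ ε).2) (𝓝 0) (𝓝 μ) := by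
      have := (continuous_snd.continuousAt.comp hψ.continuousAt).tendsto
      rw [Function.comp_apply, hψ0] at this
      exact this
    exact this hs
  obtain ⟨δ, hδ, hδall⟩ := Metric.eventually_nhds_iff.1
    (((hψ.eventually_analyticAt.and ev_sol).and ev_range).and ev_s)
  have hIoo : ∀ {ε : ℝ}, ε ∈ Ioo (-δ) δ → dist ε 0 < δ := fun h => by
    rw [Real.dist_eq, sub_zero]; exact abs_lt.2 h
  have hcurve : ∀ ε ∈ Ioo (-δ) δ, (ψ ε).2 • ε • (ψ ε).1 - L (ε • (ψ ε).1) - (ε • (ψ ε).1) ^ 2 = 0 ∧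
      (ε ≠ 0 → ε • (ψ ε).1 ≠ 0) := fun ε hε => by
    obtain ⟨⟨⟨-, h1, h2⟩, -⟩, -⟩ := hδall (hIoo hε)
    constructor
    · have : (ψ ε).2 • ε • (ψ ε).1 - L (ε • (ψ ε).1) - (ε • (ψ ε).1) ^ 2 =
          ε • ((ψ ε).2 • (ψ ε).1 - L (ψ ε).1 - ε • (ψ ε).1 ^ 2) := by
        rw [map_smul, smul_pow, sq ε]; module
      rw [this, h1, smul_zero]
    · intro h0
      refine smul_ne_zero h0 fun h => ?_
      rw [h, map_zero] at h2
      exact zero_ne_one h2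
  refine ⟨δ, fun ε => ε • (ψ ε).1, fun ε => (ψ ε).2, hδ, fun ε hε => ?_, fun ε hε => ?_, by simp,
    by simp [hψ0], ?_, fun ε hε => ?_, ?_⟩
  · have := (hδall (hIoo hε)).1.1.1
    exact analyticAt_id.smul (analyticAt_fst.comp this)
  · have := (hδall (hIoo hε)).1.1.1
    exact analyticAt_snd.comp this
  · have hd : HasDerivAt (fun ε => (ψ ε).1) _ 0 :=
      (analyticAt_fst.comp hψ).differentiableAt.hasDerivAt
    have := (hasDerivAt_id (0 : ℝ)).smul hd
    rw [id, zero_smul, zero_add, one_smul, hψ0] at this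
    exact this
  · obtain ⟨⟨⟨-, -⟩, ⟨b, hb⟩⟩, h4⟩ := hδall (hIoo hε)
    exact ⟨h4, (hcurve ε hε).1, ⟨ε • b, by rw [map_smul, hb]⟩, (hcurve ε hε).2⟩
  · have ev_small : ∀ᶠ v in 𝓝 ((0 : ℝ), (e, μ)), v.1 ∈ Ioo (-δ) δ :=
      continuous_fst.continuousAt.eventually_mem (Ioo_mem_nhds (by simpa using hδ) hδ)
    filter_upwards [eventually_rescaled hbij hLe hae (hψiff.and ev_small)] with ⟨φ, ν⟩ hp
    constructor
    · rintro ⟨hφ, hsol⟩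
      obtain ⟨h0, hiff, hmem⟩ := hp hφ hsol
      simp only at h0 hiff hmem hsol
      have hψε := hiff.1 ⟨by
        have : ν • (a φ)⁻¹ • φ - L ((a φ)⁻¹ • φ) - a φ • ((a φ)⁻¹ • φ) ^ 2 =
            (a φ)⁻¹ • (ν • φ - L φ - φ ^ 2) := by
          rw [map_smul, smul_pow, smul_smul (a φ), sq (a φ)⁻¹, mul_inv_cancel_left₀ h0]; module
        rw [this, hsol, smul_zero], by simp [h0]⟩
      refine ⟨a φ, hmem, h0, ?_⟩
      rw [hψε]
      simp [smul_smul, h0]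
    · rintro ⟨ε, hε, h0, heq⟩
      rw [Prod.mk_inj] at heq
      rw [heq.1, heq.2]
      exact ⟨(hcurve ε hε).2 h0, (hcurve ε hε).1⟩

end SimpleEigenvalue

section

open EvenHolder

variable {α : ℝ≥0}

theorem isSolution_iff (hα : 1 / 2 < α) (hα' : α ≤ 1) (p : EvenHolder α × ℝ) :
    IsSolution p ↔ p.2 • p.1 - whithamCLM hα' p.1 - p.1 ^ 2 = 0 := by
  rw [EvenHolder.ext_iff]
  exact forall_congr' fun x => by
    simp only [F, sub_apply, smul_apply, pow_apply, zero_apply, whithamCLM_apply hα]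

theorem whithamCLM_cosMode (hα : 1 / 2 < α) (hα' : α ≤ 1) (k : ℕ) :
    whithamCLM hα' (cosMode hα' k) = symbol k • cosMode hα' k := by
  ext x
  rw [whithamCLM_apply hα, L, tsum_eq_single k fun j hj => by
    rw [cosCoeff_cosMode, if_neg hj.symm, zero_mul, zero_mul]]
  simp [cosCoeff_cosMode]

theorem eq_zero_of_whithamCLM_eq_smul (hα : 1 / 2 < α) (hα' : α ≤ 1) {μ : ℝ} (hμ : μ ≠ 0)
    {v : EvenHolder α} (hv : whithamCLM hα' v = μ • v)
    (hcoeff : ∀ k : ℕ, symbol k = μ → cosCoeff v k = 0) : v = 0 := by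
  have h0 : ∀ k : ℕ, cosCoeff v k = 0 := fun k => by
    by_cases hk : symbol k = μ
    · exact hcoeff k hk
    · have h := cosCoeff_whithamCLM hα' v k
      rw [hv, ← coeffCLM_apply, map_smul, coeffCLM_apply, smul_eq_mul] at h
      exact (mul_eq_zero.1 (by linear_combination h : (μ - symbol k) * cosCoeff v k = 0)).resolve_left
        (sub_ne_zero.2 (Ne.symm hk))
  have h1 : μ • v = 0 := by
    rw [← hv]
    ext x
    simp [whithamCLM_apply hα, L, h0]
  exact (smul_eq_zero.1 h1).resolve_left hμ

theorem symbol_pos (k : ℕ) : 0 < symbol k := by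
  rcases eq_or_ne k 0 with rfl | hk
  · rw [Nat.cast_zero, symbol_zero]; exact one_pos
  · rw [symbol_eq_muStar hk]; exact muStar_pos hk

theorem linearized_whithamCLM_bijective (hα : 1 / 2 < α) (hα' : α ≤ 1) (k : ℕ) :
    Function.Bijective
      (linearized (whithamCLM hα') (coeffCLM k) (cosMode hα' k) (symbol k)) :=
  linearized_bijective (isCompactOperator_whithamCLM hα') (symbol_pos k).ne'
    (by simp [cosCoeff_cosMode]) (fun v => cosCoeff_whithamCLM hα' v k)
    fun _ hv ha => eq_zero_of_whithamCLM_eq_smul hα hα' (symbol_pos k).ne' hv fun _ hj =>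
      symbol_strictAnti.injective hj ▸ ha

/-- The `T`-periodic functions in `C^α_even(𝕊)`. -/
def periodicSubalgebra (α : ℝ≥0) (T : ℝ) : Subalgebra ℝ (EvenHolder α) where
  carrier := {f | Function.Periodic f T}
  mul_mem' hf hg := hf.mul hg
  add_mem' hf hg := hf.add hg
  algebraMap_mem' c x := by
    change (c • (1 : EvenHolder α)) (x + T) = (c • (1 : EvenHolder α)) x
    simp

theorem isClosed_periodicSubalgebra (T : ℝ) :
    IsClosed (periodicSubalgebra α T : Set (EvenHolder α)) := by
  have : (periodicSubalgebra α T : Set (EvenHolder α)) =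
      ⋂ x : ℝ, {f | evalCLM (x + T) f = evalCLM x f} := by
    ext f; simp [periodicSubalgebra, Function.Periodic]
  rw [this]
  exact isClosed_iInter fun x => isClosed_eq (evalCLM _).continuous (evalCLM _).continuous

theorem cosCoeff_mul_cos_sub_one {f : EvenHolder α} {T : ℝ} (hf : Function.Periodic f T) (k : ℕ) :
    cosCoeff f k * (Real.cos (k * T) - 1) = 0 := by
  set I := ∫ x in (-Real.pi)..Real.pi, f x * Real.cos (k * x) with hI
  have hper : Function.Periodic (fun x => f x * Real.cos (k * x)) (2 * Real.pi) := fun x => by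
    simp [f.periodic x, mul_add]
  have h1 : ∫ x in (-Real.pi)..Real.pi, f (x + T) * Real.cos (k * (x + T)) = I := by
    rw [intervalIntegral.integral_comp_add_right (fun x => f x * Real.cos (k * x))]
    have := hper.intervalIntegral_add_eq (-Real.pi + T) (-Real.pi)
    rw [hI]
    convert this using 2 <;> ring
  have h2 : ∀ x, f (x + T) * Real.cos (k * (x + T)) =
      Real.cos (k * T) * (f x * Real.cos (k * x)) -
        Real.sin (k * T) * (f x * Real.sin (k * x)) := fun x => by
    rw [hf x, mul_add, Real.cos_add]; ring
  simp only [h2] at h1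
  rw [intervalIntegral.integral_sub, intervalIntegral.integral_const_mul,
    intervalIntegral.integral_const_mul, f.integral_mul_sin, mul_zero, sub_zero] at h1
  · have h3 : cosCoeff f k = (2 * Real.pi)⁻¹ * freqWeight k * I := by
      rw [cosCoeff_eq, mul_assoc, hI]
      simp only [mul_left_comm (f _), intervalIntegral.integral_const_mul]
    rw [h3]
    linear_combination ((2 * Real.pi)⁻¹ * freqWeight k) * h1
  · exact (continuous_const.mul (f.continuous.mul (by fun_prop))).intervalIntegrable _ _
  · exact (continuous_const.mul (f.continuous.mul (by fun_prop))).intervalIntegrable _ _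

theorem whithamCLM_mem_periodicSubalgebra (hα : 1 / 2 < α) (hα' : α ≤ 1) {T : ℝ}
    {f : EvenHolder α} (hf : f ∈ periodicSubalgebra α T) :
    whithamCLM hα' f ∈ periodicSubalgebra α T := fun x => by
  rw [whithamCLM_apply hα, whithamCLM_apply hα]
  refine tsum_congr fun k => ?_
  rcases mul_eq_zero.1 (cosCoeff_mul_cos_sub_one hf k) with h | h
  · simp [h]
  · have hc : Real.cos (k * T) = 1 := by linarith
    have hsin : Real.sin (k * T) = 0 := by
      have := Real.sin_sq_add_cos_sq (k * T)
      rw [hc] at this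
      exact pow_eq_zero_iff two_ne_zero |>.1 (by linarith)
    rw [mul_add, Real.cos_add, hc, hsin]
    ring

theorem cosMode_mem_periodicSubalgebra (hα : α ≤ 1) {k : ℕ} (hk : k ≠ 0) :
    cosMode hα k ∈ periodicSubalgebra α (2 * Real.pi / k) := fun x => by
  have : (k : ℝ) ≠ 0 := by exact_mod_cast hk
  rw [cosMode_apply, cosMode_apply, mul_add, mul_div_cancel₀ _ this, Real.cos_add_two_pi]

/-- The operator `L` on the `T`-periodic functions. -/
def whithamPeriodicCLM (hα : 1 / 2 < α) (hα' : α ≤ 1) (T : ℝ) :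
    periodicSubalgebra α T →L[ℝ] periodicSubalgebra α T :=
  LinearMap.mkContinuous
    { toFun := fun v => ⟨whithamCLM hα' v, whithamCLM_mem_periodicSubalgebra hα hα' v.2⟩
      map_add' := fun v w => Subtype.ext (map_add (whithamCLM hα') (v : EvenHolder α) w)
      map_smul' := fun c v => Subtype.ext (map_smul (whithamCLM hα') c (v : EvenHolder α)) }
    ‖whithamCLM hα'‖ fun v => (whithamCLM hα').le_opNorm v

theorem isCompactOperator_whithamPeriodicCLM (hα : 1 / 2 < α) (hα' : α ≤ 1) (T : ℝ) :
    IsCompactOperator (whithamPeriodicCLM hα hα' T) :=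
  ((isCompactOperator_whithamCLM hα').comp_clm
    (Subalgebra.toSubmodule (periodicSubalgebra α T)).subtypeL).codRestrict
    (V := Subalgebra.toSubmodule (periodicSubalgebra α T))
    (fun v => whithamCLM_mem_periodicSubalgebra hα hα' v.2) (isClosed_periodicSubalgebra T)

/-- The `k`-th cosine coefficient on the `T`-periodic functions. -/
def coeffPeriodicCLM (k : ℕ) (T : ℝ) : periodicSubalgebra α T →L[ℝ] ℝ :=
  (coeffCLM k).comp (Subalgebra.toSubmodule (periodicSubalgebra α T)).subtypeL

theorem coeffPeriodicCLM_apply (k : ℕ) (T : ℝ) (v : periodicSubalgebra α T) :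
    coeffPeriodicCLM k T v = coeffCLM k (v : EvenHolder α) := rfl

theorem exists_whitham_curve (hα : 1 / 2 < α) (hα' : α ≤ 1) {k : ℕ} (hk : k ≠ 0) :
    ∃ (δ : ℝ) (φ : ℝ → EvenHolder α) (ν : ℝ → ℝ), 0 < δ ∧
      AnalyticOnNhd ℝ φ (Ioo (-δ) δ) ∧ AnalyticOnNhd ℝ ν (Ioo (-δ) δ) ∧
      φ 0 = 0 ∧ ν 0 = muStar k ∧ HasDerivAt φ (cosMode hα' k) 0 ∧
      (∀ ε ∈ Ioo (-δ) δ, ν ε ∈ Ioo (0 : ℝ) 1 ∧ IsSolution (φ ε, ν ε) ∧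
        Function.Periodic (φ ε : ℝ → ℝ) (2 * Real.pi / k) ∧ (ε ≠ 0 → φ ε ≠ 0)) ∧
      ∀ᶠ p in 𝓝 ((0 : EvenHolder α), muStar k), (p.1 ≠ 0 ∧ IsSolution p) ↔
        ∃ ε ∈ Ioo (-δ) δ, ε ≠ 0 ∧ p = (φ ε, ν ε) := by
  set T := 2 * Real.pi / k
  have : CompleteSpace (periodicSubalgebra α T) :=
    (isClosed_periodicSubalgebra T).completeSpace_coe
  have hbijB : Function.Bijective (linearized (whithamPeriodicCLM hα hα' T) (coeffPeriodicCLM k T)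
      ⟨cosMode hα' k, cosMode_mem_periodicSubalgebra hα' hk⟩ (symbol k)) :=
    linearized_bijective (isCompactOperator_whithamPeriodicCLM hα hα' T) (symbol_pos k).ne'
      (by simp [coeffPeriodicCLM_apply, cosCoeff_cosMode])
      (fun v => cosCoeff_whithamCLM hα' (v : EvenHolder α) k)
      fun v hv ha => Subtype.ext <| eq_zero_of_whithamCLM_eq_smul hα hα' (symbol_pos k).ne'
        (congrArg Subtype.val hv) fun _ hj => symbol_strictAnti.injective hj ▸ ha
  have hs : Ioo (0 : ℝ) 1 ∈ 𝓝 (symbol k) := by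
    rw [symbol_eq_muStar hk]; exact Ioo_mem_nhds (muStar_pos hk) (muStar_lt_one hk)
  obtain ⟨δ, φ, ν, hδ, hφ, hν, hφ0, hν0, hd, hcurve, hloc⟩ :=
    exists_bifurcation_curve (linearized_whithamCLM_bijective hα hα' k)
      (whithamCLM_cosMode hα hα' k) (by simp [cosCoeff_cosMode]) hs
      (ι := (periodicSubalgebra α T).val) continuous_subtype_val Subtype.val_injective
      (fun _ => rfl) (fun _ => rfl) rfl hbijB
  rw [symbol_eq_muStar hk] at hν0 hloc
  refine ⟨δ, φ, ν, hδ, hφ, hν, hφ0, hν0, hd, fun ε hε => ?_, ?_⟩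
  · obtain ⟨h1, h2, ⟨v, hv⟩, h4⟩ := hcurve ε hε
    exact ⟨h1, (isSolution_iff hα hα' _).2 h2, hv ▸ v.2, h4⟩
  · simpa only [isSolution_iff hα hα'] using hloc

theorem isSolution_zero (α : ℝ≥0) (hα : 1 / 2 < α) (hα' : α ≤ 1) (μ : ℝ) :
    IsSolution ((0 : EvenHolder α), μ) := by
  rw [isSolution_iff hα hα']; simp

theorem isSolution_const (hα : 1 / 2 < α) (hα' : α ≤ 1) (μ : ℝ) :
    IsSolution (const α (μ - 1), μ) := by
  have h1 := whithamCLM_cosMode hα hα' 0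
  rw [cosMode_zero, Nat.cast_zero, symbol_zero, one_smul] at h1
  rw [isSolution_iff hα hα', const_eq_smul_one, map_smul, h1]
  ext x
  simp
  ring

theorem eventually_isSolution_iff_const (hα : 1 / 2 < α) (hα' : α ≤ 1) :
    ∀ᶠ p in 𝓝 ((0 : EvenHolder α), (1 : ℝ)),
      IsSolution p ↔ p.1 = 0 ∨ p.1 = const α (p.2 - 1) := by
  have hbij := linearized_whithamCLM_bijective hα hα' 0
  have h1 := whithamCLM_cosMode hα hα' 0
  have hcoeff1 := cosCoeff_cosMode hα' 0 0
  rw [cosMode_zero, Nat.cast_zero, symbol_zero] at hbij h1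
  rw [cosMode_zero, if_pos rfl] at hcoeff1
  rw [one_smul] at h1
  obtain ⟨C, hC0, hC⟩ := exists_norm_le_mul_of_bijective hbij
  have hsmall : ∀ᶠ p in 𝓝 ((0 : EvenHolder α), (1 : ℝ)),
      C * (|1 - p.2| + 2 * |coeffCLM 0 p.1| + ‖p.1 - coeffCLM 0 p.1 • (1 : EvenHolder α)‖) < 1 := by
    have hc : Continuous fun p : EvenHolder α × ℝ =>
      C * (|1 - p.2| + 2 * |coeffCLM 0 p.1| + ‖p.1 - coeffCLM 0 p.1 • (1 : EvenHolder α)‖) := by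
      fun_prop
    refine hc.continuousAt.eventually_lt_const ?_
    simp only [map_zero, zero_smul]
    simp
  filter_upwards [hsmall] with ⟨φ, μ⟩ hp
  constructor
  swap
  · rintro (h | h)
    · simp only at h; subst h; exact isSolution_zero α hα hα' μ
    · simp only at h; subst h; exact isSolution_const hα hα' μ
  intro hsol
  rw [isSolution_iff hα hα'] at hsol
  simp only at hp hsol ⊢
  set c := coeffCLM 0 φ with hcdef
  obtain ⟨w, hw⟩ : ∃ w, w = φ - c • (1 : EvenHolder α) := ⟨_, rfl⟩
  have hφ : φ = c • (1 : EvenHolder α) + w := by rw [hw]; abel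
  rw [← hw] at hp
  have hlin : linearized (whithamCLM hα') (coeffCLM 0) 1 1 (w, (μ - 1) * c - c ^ 2) =
      ((1 - μ) • w + (2 * c) • w + w * w, 0) := by
    rw [linearized_apply, Prod.mk_inj]
    constructor
    · rw [hφ, map_add, map_smul, h1] at hsol
      have h2 : (c • (1 : EvenHolder α) + w) ^ 2 = c ^ 2 • (1 : EvenHolder α) + (2 * c) • w + w * w := by
        ext x; simp; ring
      rw [h2] at hsol
      rw [← sub_eq_zero, ← hsol]
      module
    · simp only [hw, map_sub, map_smul, coeffCLM_apply, hcoeff1, hcdef]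
      simp
  have hw0 : w = 0 := by
    by_contra hne
    have hwpos : 0 < ‖w‖ := norm_pos_iff.2 hne
    have h2 : ‖w‖ ≤ C * (|1 - μ| + 2 * |c| + ‖w‖) * ‖w‖ := by
      calc ‖w‖ ≤ ‖(w, (μ - 1) * c - c ^ 2)‖ := norm_fst_le (w, (μ - 1) * c - c ^ 2)
        _ ≤ C * ‖(1 - μ) • w + (2 * c) • w + w * w‖ := by
          refine (hC _).trans_eq ?_
          rw [hlin, Prod.norm_mk, norm_zero, max_eq_left (norm_nonneg _)]
        _ ≤ C * (|1 - μ| * ‖w‖ + 2 * |c| * ‖w‖ + ‖w‖ * ‖w‖) := by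
          gcongr
          refine (norm_add₃_le).trans (add_le_add (add_le_add ?_ ?_) (norm_mul_le _ _))
          · exact (norm_smul _ _).le
          · rw [norm_smul, norm_mul, Real.norm_two, Real.norm_eq_abs]
        _ = _ := by ring
    nlinarith
  rw [hw0] at hlin hφ
  have h3 := congrArg (fun q : EvenHolder α × ℝ => q.1 0) hlin
  simp at h3
  have h4 : c * (μ - 1 - c) = 0 := by linear_combination h3
  rw [add_zero] at hφ
  rcases mul_eq_zero.1 h4 with h | h
  · left; rw [hφ, h, zero_smul]
  · right
    rw [const_eq_smul_one, hφ, show c = μ - 1 by linarith]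

theorem not_isBifurcationPoint (hα : 1 / 2 < α) (hα' : α ≤ 1) {μ : ℝ} (hμ : μ ≠ 0)
    (h : ∀ k : ℕ, symbol k ≠ μ) : ¬IsBifurcationPoint α μ := by
  have heig : ¬Module.End.HasEigenvalue (whithamCLM hα' : Module.End ℝ (EvenHolder α)) μ := by
    intro he
    obtain ⟨v, hv⟩ := he.exists_hasEigenvector
    exact hv.2 (eq_zero_of_whithamCLM_eq_smul hα hα' hμ hv.apply_eq_smul fun k hk => absurd hk (h k))
  obtain ⟨K, hK⟩ :=
    (isCompactOperator_whithamCLM hα').antilipschitz_of_not_hasEigenvalue hμ heig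
  have hsmall : ∀ᶠ p in 𝓝 ((0 : EvenHolder α), μ), K * (|p.2 - μ| + ‖p.1‖) < 1 := by
    have hc : Continuous fun p : EvenHolder α × ℝ => K * (|p.2 - μ| + ‖p.1‖) := by fun_prop
    exact hc.continuousAt.eventually_lt_const (by simp)
  rw [IsBifurcationPoint, not_frequently]
  filter_upwards [hsmall] with ⟨φ, ν⟩ hp
  rintro ⟨hφ, hsol⟩
  rw [isSolution_iff hα hα'] at hsol
  simp only at hp hφ hsol
  have hpos := norm_pos_iff.2 hφ
  have h1 := hK.le_mul_dist φ 0
  rw [map_zero, dist_zero_right, dist_zero_right] at h1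
  have h2 : (whithamCLM hα' - μ • 1) φ = (ν - μ) • φ - φ * φ := by
    have : whithamCLM hα' φ = ν • φ - φ ^ 2 := by
      rw [← sub_eq_zero, ← neg_eq_zero, ← hsol]; abel
    simp only [_root_.sub_apply, _root_.smul_apply, one_apply_eq_self, this]
    rw [sub_smul, sq]; abel
  have h3 : ‖(whithamCLM hα' - μ • 1) φ‖ ≤ (|ν - μ| + ‖φ‖) * ‖φ‖ := by
    rw [h2, add_mul]
    exact (norm_sub_le _ _).trans (add_le_add (norm_smul _ _).le (norm_mul_le _ _))
  have h4 : ‖φ‖ ≤ K * (|ν - μ| + ‖φ‖) * ‖φ‖ := by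
    rw [mul_assoc]
    exact h1.trans (mul_le_mul_of_nonneg_left h3 K.2)
  nlinarith

theorem isBifurcationPoint_of_curve {φ : ℝ → EvenHolder α} {ν : ℝ → ℝ} {μ : ℝ}
    (hφ : ContinuousAt φ 0) (hν : ContinuousAt ν 0) (hφ0 : φ 0 = 0) (hν0 : ν 0 = μ)
    (h : ∀ᶠ ε in 𝓝[≠] (0 : ℝ), φ ε ≠ 0 ∧ IsSolution (φ ε, ν ε)) : IsBifurcationPoint α μ := by
  have ht : Tendsto (fun ε => (φ ε, ν ε)) (𝓝[≠] 0) (𝓝 ((0 : EvenHolder α), μ)) := by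
    have := (hφ.prodMk hν).tendsto.mono_left (nhdsWithin_le_nhds (s := {0}ᶜ))
    rwa [hφ0, hν0] at this
  exact ht.frequently h.frequently

theorem isBifurcationPoint_muStar (hα : 1 / 2 < α) (hα' : α ≤ 1) {k : ℕ} (hk : k ≠ 0) :
    IsBifurcationPoint α (muStar k) := by
  obtain ⟨δ, φ, ν, hδ, hφ, hν, hφ0, hν0, -, hcurve, -⟩ := exists_whitham_curve hα hα' hk
  have h0 : (0 : ℝ) ∈ Ioo (-δ) δ := ⟨neg_neg_iff_pos.2 hδ, hδ⟩
  refine isBifurcationPoint_of_curve (hφ 0 h0).continuousAt (hν 0 h0).continuousAt hφ0 hν0 ?_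
  filter_upwards [self_mem_nhdsWithin, nhdsWithin_le_nhds (Ioo_mem_nhds h0.1 h0.2)] with ε hε hmem
  obtain ⟨-, h2, -, h4⟩ := hcurve ε hmem
  exact ⟨h4 hε, h2⟩

theorem isBifurcationPoint_one (hα : 1 / 2 < α) (hα' : α ≤ 1) : IsBifurcationPoint α 1 := by
  refine isBifurcationPoint_of_curve (φ := fun ε => const α (1 + ε - 1)) (ν := fun ε => 1 + ε)
    ?_ (by fun_prop) (by ext x; simp) (by simp) ?_
  · simp only [const_eq_smul_one]; fun_prop
  · filter_upwards [self_mem_nhdsWithin] with ε hε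
    refine ⟨fun h => hε ?_, isSolution_const hα hα' _⟩
    have := congrArg (fun f : EvenHolder α => f 0) h
    simpa using this

theorem isBifurcationPoint_iff (hα : 1 / 2 < α) (hα' : α ≤ 1) {μ : ℝ} (hμ : 0 < μ) :
    IsBifurcationPoint α μ ↔ (∃ k : ℕ, 1 ≤ k ∧ μ = muStar k) ∨ μ = 1 := by
  constructor
  · intro h
    by_contra! hne
    refine not_isBifurcationPoint hα hα' hμ.ne' (fun k hk => ?_) h
    rcases eq_or_ne k 0 with rfl | hk0
    · rw [Nat.cast_zero, symbol_zero] at hk; exact hne.2 hk.symm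
    · exact hne.1 k (Nat.pos_of_ne_zero hk0) (hk.symm.trans (symbol_eq_muStar hk0))
  · rintro (⟨k, hk, rfl⟩ | rfl)
    · exact isBifurcationPoint_muStar hα hα' (by omega)
    · exact isBifurcationPoint_one hα hα'

end

end Whitham

end

theorem corollary3p2 (α : ℝ≥0) (hα : 1 / 2 < α) (hα' : α < 1) :
    -- (i) for each `k ≥ 1`, the curve of `2π/k`-periodic solutions through `(0, μ_k)`
    (∀ k : ℕ, 1 ≤ k →
      ∃ (δ : ℝ) (φ : ℝ → Whitham.EvenHolder α) (μ : ℝ → ℝ),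
        0 < δ ∧
        AnalyticOnNhd ℝ φ (Ioo (-δ) δ) ∧
        AnalyticOnNhd ℝ μ (Ioo (-δ) δ) ∧
        φ 0 = 0 ∧ μ 0 = Whitham.muStar k ∧
        (∃ e : Whitham.EvenHolder α, (∀ x, e x = Real.cos (k * x)) ∧ HasDerivAt φ e 0) ∧
        (∀ ε ∈ Ioo (-δ) δ,
          μ ε ∈ Ioo (0 : ℝ) 1 ∧
          Whitham.IsSolution (φ ε, μ ε) ∧
          Function.Periodic (φ ε : ℝ → ℝ) (2 * Real.pi / k) ∧
          (ε ≠ 0 → φ ε ≠ 0)) ∧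
        -- near `(0, μ_k)` there are no other nontrivial solutions
        (∀ᶠ p in 𝓝 ((0 : Whitham.EvenHolder α), Whitham.muStar k),
          (p.1 ≠ 0 ∧ Whitham.IsSolution p) ↔
            ∃ ε ∈ Ioo (-δ) δ, ε ≠ 0 ∧ p = (φ ε, μ ε))) ∧
    -- the bifurcation points `μ > 0` are exactly the `μ_k`, `k ≥ 1`, and `1`
    (∀ μ : ℝ, 0 < μ →
      (Whitham.IsBifurcationPoint α μ ↔
        (∃ k : ℕ, 1 ≤ k ∧ μ = Whitham.muStar k) ∨ μ = 1)) ∧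
    -- (ii) the trivial and the constant solutions, which are all solutions near `(0, 1)`
    (∀ μ : ℝ, 0 < μ →
      Whitham.IsSolution ((0 : Whitham.EvenHolder α), μ) ∧
      Whitham.IsSolution (Whitham.EvenHolder.const α (μ - 1), μ)) ∧
    (∀ᶠ p in 𝓝 ((0 : Whitham.EvenHolder α), (1 : ℝ)),
      Whitham.IsSolution p ↔ p.1 = 0 ∨ p.1 = Whitham.EvenHolder.const α (p.2 - 1)) := by
  refine ⟨fun k hk => ?_, fun μ hμ => Whitham.isBifurcationPoint_iff hα hα'.le hμ, fun μ _ =>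
    ⟨Whitham.isSolution_zero α hα hα'.le μ, Whitham.isSolution_const hα hα'.le μ⟩,
    Whitham.eventually_isSolution_iff_const hα hα'.le⟩
  obtain ⟨δ, φ, ν, hδ, hφ, hν, hφ0, hν0, hd, hcurve, hloc⟩ :=
    Whitham.exists_whitham_curve hα hα'.le (k := k) (by omega)
  exact ⟨δ, φ, ν, hδ, hφ, hν, hφ0, hν0, ⟨_, fun _ => rfl, hd⟩, hcurve, hloc⟩
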